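/- Let $L^{(0)}=\partial+\partial^{-1}+\partial^{-3}+\partial^{-5}+\cdots$ be the seed Lax operator of the BKP hierarchy (so $u_2^{(0)}=1$), with $x=t_1$, $y=t_3$, $t=t_5$. For $m=1,2$ let $$\varphi_m(x,y,t)=\sum_{i=1}^{n_m}k_{m,i}\,e^{a_{m,i}x+\alpha_{m,i}y+\beta_{m,i}t},\qquad n_m\ge 1,\quad k_{m,i}>0,$$ where the real numbers $\alpha=\alpha_{m,i}$, $\beta=\beta_{m,i}$ satisfy $$\alpha^5-25\alpha^3+30\beta\alpha^2+1215\alpha-\beta^3-243\beta=0$$ and $$a_{m,i}=\frac{\alpha_{m,i}^3-18\alpha_{m,i}+9\beta_{m,i}}{\alpha_{m,i}^2+\alpha_{m,i}\beta_{m,i}+81}.$$ Assume $0<3a_{1,i}<a_{2,j}$ for all $i,j$. Put $$IW_{2,2}=IW_{2,2}(\varphi_{2,x},\varphi_{1,x};\varphi_1,\varphi_2)=\begin{vmatrix}\int\varphi_1\varphi_{2,x}&\int\varphi_2\varphi_{2,x}\\ \int\varphi_1\varphi_{1,x}&\int\varphi_2\varphi_{1,x}\end{vmatrix},\qquad \int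 f:=\int_{-\infty}^x f(s,y,t)\,ds .$$ Then these integrals converge and $IW_{2,2}<0$ on all of $\mathbb R^3$. Let $u_2^{(2+2)}$ be the coefficient of $\partial^{-1}$ in the Lax operator that arises from $L^{(0)}$ by two gauge transformations $T_D(\chi)=\chi\,\partial\,\chi^{-1}$ generated by the eigenfunctions $\varphi_1,\varphi_2$, followed by two gauge transformations $T_I(\chi)=\chi^{-1}\partial^{-1}\chi$ generated by the conjugate eigenfunctions $\psi_1=\varphi_{1,x}$, $\psi_2=\varphi_{2,x}$, where each generating function is first transformed by the earlier steps (an eigenfunction $f$ becomes $Tf$ and a conjugate eigenfunction $g$ becomes $(T^{-1})^*g$, with $\partial^{-1}=\int_{-\infty}^x$). Then $$u_2^{(2+2)}=1+\left(\log|IW_{2,2}|\right)_{xx},$$ and $u=u_2^{(2+2)}$ is a nonsingular (that is, $C^\infty$ on all of $\mathbb R^3$) solution of the $(2+1)$-dimensional Sawada–Kotera equation $$u_t=\tfrac59\left(\partial_x^{-1}u_{yy}+3u_x\,\partial_x^{-1}u_y-\tfrac15u_{xxxxx}-3uu_{xxx}-3u_xu_{xx}-9u^2u_x+u_{xxy}+3uu_y\right),$$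 where $\partial_x^{-1}u_y$ denotes the $x$-primitive $v=6+(\log|IW_{2,2}|)_{xy}$ of $u_y$, and $\partial_x^{-1}u_{yy}=v_y$. (For a BKP Lax operator $\partial+u\,\partial^{-1}-u_x\partial^{-2}+u_4\partial^{-3}+\cdots$ one has $\partial_x^{-1}u_y=3u_4-2u_{xx}+3u^2$, which equals $6$ for the seed.) -/

import Mathlib

namespace BKP

noncomputable section

/-! ### Functions of `(x, y, t)`, their partial derivatives and exponential sums -/

/-- Real functions of the three variables `x`, `y`, `t`, in this order. -/
abbrev Fun3 : Type := ℝ → ℝ → ℝ → ℝ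

/-- The partial derivative with respect to `x`. -/
def dx (f : Fun3) : Fun3 := fun x y t => deriv (fun s => f s y t) x

/-- The partial derivative with respect to `y`. -/
def dy (f : Fun3) : Fun3 := fun x y t => deriv (fun s => f x s t) y

/-- The partial derivative with respect to `t`. -/
def dt (f : Fun3) : Fun3 := fun x y t => deriv (fun s => f x y s) t

/-- Smoothness on the whole of `ℝ³`, i.e. absence of singularities. -/
def IsSmooth (f : Fun3) : Prop :=
  ContDiff ℝ (⊤ : ℕ∞) (fun p : ℝ × ℝ × ℝ => f p.1 p.2.1 p.2.2)

/-- The exponent in the `x`-direction that belongs to the exponents `α`, `β` in the directions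
of `y` and `t`. -/
def waveNumber (α β : ℝ) : ℝ := (α ^ 3 - 18 * α + 9 * β) / (α ^ 2 + α * β + 81)

/-- The algebraic relation between the exponents `α` and `β`. -/
def IsDispersion (α β : ℝ) : Prop :=
  α ^ 5 - 25 * α ^ 3 + 30 * β * α ^ 2 + 1215 * α - β ^ 3 - 243 * β = 0

/-- The exponential sum `∑ kᵢ exp (aᵢ x + αᵢ y + βᵢ t)` with `aᵢ = waveNumber αᵢ βᵢ`. -/
def expSum {n : ℕ} (k α β : Fin n → ℝ) : Fun3 := fun x y t =>
  ∑ i, k i * Real.exp (waveNumber (α i) (β i) * x + α i * y + β i * t)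

/-! ### The determinant -/

/-- The determinant `IW_{n,n}(ψ₁, …, ψₙ; φ₁, …, φₙ)` with entries `∫ φⱼ ψᵢ dx` in row `i` and
column `j`, the integral being the `x`-primitive that starts at `-∞`. -/
def IW {n : ℕ} (ψ φ : Fin n → Fun3) : Fun3 := fun x y t =>
  (Matrix.of fun i j => ∫ s in Set.Iic x, φ j s y t * ψ i s y t).det

/-! ### Pseudo-differential operators in `x` and gauge transformations

The variables `y` and `t` are parameters here, so the coefficients are functions of `x` only. -/

/-- The pseudo-differential operator `∑ₖ P k ∂ᵏ`. All operators below are of finite order, that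
is, `P k = 0` for all large `k`. -/
abbrev PsiDO : Type := ℤ → ℝ → ℝ

/-- Composition, by the rule `∂ⁱ ∘ f = ∑_{l ≥ 0} (i choose l) f⁽ˡ⁾ ∂ⁱ⁻ˡ` with generalized binomial
coefficients. For operators of finite order the sum giving each coefficient is finite. -/
def PsiDO.comp (P Q : PsiDO) : PsiDO := fun k x =>
  ∑ᶠ p : ℤ × ℕ, ((Ring.choose p.1 p.2 : ℤ) : ℝ) * P p.1 x * iteratedDeriv p.2 (Q (k - p.1 + p.2)) x

/-- The operator of multiplication by `f`. -/
def PsiDO.mul (f : ℝ → ℝ) : PsiDO := fun k x => if k = 0 then f x else 0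

/-- The operator `∂ᵐ`. -/
def PsiDO.partial (m : ℤ) : PsiDO := fun k _ => if k = m then 1 else 0

/-- `f ∂ᵐ f⁻¹`. -/
def PsiDO.dressed (m : ℤ) (f : ℝ → ℝ) : PsiDO :=
  ((PsiDO.mul f).comp (PsiDO.partial m)).comp (PsiDO.mul fun x => (f x)⁻¹)

/-- `L ↦ T L T⁻¹` for the differential gauge operator `T = φ ∂ φ⁻¹`, with `T⁻¹ = φ ∂⁻¹ φ⁻¹`. -/
def gaugeD (φ : ℝ → ℝ) (L : PsiDO) : PsiDO :=
  ((PsiDO.dressed 1 φ).comp L).comp (PsiDO.dressed (-1) φ)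

/-- `L ↦ T L T⁻¹` for the integral gauge operator `T = ψ⁻¹ ∂⁻¹ ψ`, with `T⁻¹ = ψ⁻¹ ∂ ψ`. -/
def gaugeI (ψ : ℝ → ℝ) (L : PsiDO) : PsiDO :=
  ((PsiDO.dressed (-1) fun x => (ψ x)⁻¹).comp L).comp (PsiDO.dressed 1 fun x => (ψ x)⁻¹)

/-- Transform `T f` of an eigenfunction `f` under `T = φ ∂ φ⁻¹`. -/
def eigenD (φ f : ℝ → ℝ) : ℝ → ℝ := fun x => φ x * deriv (fun s => (φ s)⁻¹ * f s) x

/-- Transform `(T⁻¹)* g = - φ⁻¹ ∫ φ g` of a conjugate eigenfunction `g` under `T = φ ∂ φ⁻¹`. -/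
def conjD (φ g : ℝ → ℝ) : ℝ → ℝ := fun x => -((φ x)⁻¹ * ∫ s in Set.Iic x, φ s * g s)

/-- Transform `(T⁻¹)* g = - ψ (ψ⁻¹ g)'` of a conjugate eigenfunction `g` under
`T = ψ⁻¹ ∂⁻¹ ψ`. -/
def conjI (ψ g : ℝ → ℝ) : ℝ → ℝ := fun x => -(ψ x * deriv (fun s => (ψ s)⁻¹ * g s) x)

/-- The seed Lax operator `∂ + ∂⁻¹ + ∂⁻³ + ∂⁻⁵ + ⋯`. -/
def seedLax : PsiDO := fun k _ => if k ≤ 1 ∧ Odd k then 1 else 0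

/-- The Lax operator obtained from `L` by two differential gauge transformations, generated by
the eigenfunctions `φ₁`, `φ₂`, followed by two integral ones, generated by the conjugate
eigenfunctions `ψ₁`, `ψ₂`; each generating function is first carried along through the earlier
steps. -/
def gauge22 (φ₁ φ₂ ψ₁ ψ₂ : ℝ → ℝ) (L : PsiDO) : PsiDO :=
  let φ₂' := eigenD φ₁ φ₂
  let ψ₁' := conjD φ₂' (conjD φ₁ ψ₁)
  let ψ₂' := conjI ψ₁' (conjD φ₂' (conjD φ₁ ψ₂))
  gaugeI ψ₂' (gaugeI ψ₁' (gaugeD φ₂' (gaugeD φ₁ L)))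

/-- The function `u₂^{(2+2)}`: the coefficient of `∂⁻¹` in the gauge transform of the seed Lax
operator with generating functions `φ₁`, `φ₂` and `ψᵢ = φ_{i,x}`. -/
def gaugedU2 (φ₁ φ₂ : Fun3) : Fun3 := fun x y t =>
  gauge22 (fun s => φ₁ s y t) (fun s => φ₂ s y t) (fun s => dx φ₁ s y t) (fun s => dx φ₂ s y t)
    seedLax (-1) x

/-! ### The (2+1)-dimensional Sawada–Kotera equation -/

/-- `u` solves
`u_t = 5/9 (∂ₓ⁻¹u_yy + 3 u_x ∂ₓ⁻¹u_y - u_xxxxx/5 - 3 u u_xxx - 3 u_x u_xx - 9 u² u_x + u_xxy + 3 u u_y)`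
on all of `ℝ³`, where `∂ₓ⁻¹u_y` is the `x`-primitive `v` of `u_y`, and `∂ₓ⁻¹u_yy` is `v_y`.
For a BKP Lax operator `∂ + u ∂⁻¹ - u_x ∂⁻² + u₄ ∂⁻³ + ⋯` the `t₃`-flow gives
`v = 3 u₄ - 2 u_xx + 3 u²`; for the seed Lax operator above, `u = u₄ = 1`, this is `v = 6`. -/
def IsSKSolution (u v : Fun3) : Prop :=
  IsSmooth u ∧ IsSmooth v ∧ dx v = dy u ∧ ∀ x y t,
    dt u x y t = 5 / 9 * (dy v x y t + 3 * dx u x y t * v x y t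
      - 1 / 5 * dx (dx (dx (dx (dx u)))) x y t
      - 3 * u x y t * dx (dx (dx u)) x y t - 3 * dx u x y t * dx (dx u) x y t
      - 9 * u x y t ^ 2 * dx u x y t + dy (dx (dx u)) x y t + 3 * u x y t * dy u x y t)

end

end BKP

/-! Fix y and t, write f, g for the two exponential sums, and put A = ∫ f g', B = ∫ g f', W = f g' -
g f', τ = A - B. The diagonal entries of the determinant are A and B, the others are g²/2 and f²/2,
and A + B = f g; hence IW = -τ²/4. Termwise integration gives τ the weights (b - a)/(b + a) with b >
a > 0, so τ > 0. This settles convergence and sign (`gaugeData_exp_sum`, `IW_eq`).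

For the Lax operator only the three top coefficients matter. A gauge step of either kind, generated
by χ, keeps the shape ∂ + u ∂⁻¹ + ⋯ and adds (log χ)'' to u (`hasTop_gaugeD`, `hasTop_gaugeI`). The
four transformed generating functions are f, W/f, f τ/(2W) and -τ/(2f), with product -τ²/4, which
gives u = 1 + (log |IW|)'' (`GaugeData.gauge22_seedLax`).

For the equation, u = 1 + 2 (log τ)_xx. With v = 6 + 2 (log τ)_xy the Sawada–Kotera equation is an
x-derivative of a Hirota bilinear equation divided by τ² (`sawadaKotera_of_hirota`). The dispersion
relation forces α = a³ + 3a and β = a⁵ + 5a³ + 15a, the symbols of the differential parts of L³ and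
L⁵ for the seed. For such exponents the bilinear form of τ is a sum over pairs of terms whose
symmetrization vanishes by a rational identity in four wave numbers (`hirotaSymbol_four`,
`hirota_exponential`). -/

namespace BKP

/-! ### Leading coefficients of pseudo-differential operators under gauge transformations. -/

/-- Coefficients of a composition, counted from the top. -/
theorem PsiDO.comp_coeff {P Q : PsiDO} {m n : ℤ} (hP : ∀ k, m < k → P k = 0)
    (hQ : ∀ k, n < k → Q k = 0) (d : ℕ) {k : ℤ} (hk : k = m + n - d) (x : ℝ) :
    P.comp Q k x = ∑ a ∈ Finset.range (d + 1), ∑ l ∈ Finset.range (d + 1),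
      ((Ring.choose (m - a) l : ℤ) : ℝ) * P (m - a) x *
        iteratedDeriv l (Q (n - d + a + l)) x := by
  subst hk
  unfold PsiDO.comp
  have hinj : Function.Injective (fun q : ℕ × ℕ => ((m - q.1, q.2) : ℤ × ℕ)) := by
    rintro ⟨a, l⟩ ⟨a', l'⟩ h
    simpa using h
  rw [finsum_eq_sum_of_support_subset (s := (Finset.range (d + 1) ×ˢ Finset.range (d + 1)).map
    ⟨_, hinj⟩), Finset.sum_map, Finset.sum_product]
  · refine Finset.sum_congr rfl fun a _ => Finset.sum_congr rfl fun l _ => ?_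
    have : m + n - d - (m - a) + l = n - d + a + l := by ring
    simp [this]
  · rintro ⟨i, l⟩ h
    by_cases h1 : m < i
    · simp [hP i h1] at h
    by_cases h2 : n < m + n - d - i + l
    · simp [hQ _ h2] at h
    simp only [Finset.coe_map, Set.mem_image, Function.Embedding.coeFn_mk, Finset.mem_coe,
      Finset.mem_product, Finset.mem_range]
    exact ⟨((m - i).toNat, l), ⟨by simp only; omega, by simp only; omega⟩,
      Prod.ext (by simp only; omega) rfl⟩

theorem PsiDO.comp_eq_zero {P Q : PsiDO} {m n : ℤ} (hP : ∀ k, m < k → P k = 0)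
    (hQ : ∀ k, n < k → Q k = 0) (k : ℤ) (hk : m + n < k) : P.comp Q k = 0 := by
  funext x
  unfold PsiDO.comp
  rw [finsum_eq_zero_of_forall_eq_zero]; · rfl
  rintro ⟨i, l⟩
  by_cases h1 : m < i
  · simp [hP i h1]
  · simp [hQ (k - i + l) (by omega)]

/-- `P = c₀ ∂ᵐ + c₁ ∂ᵐ⁻¹ + c₂ ∂ᵐ⁻² + ⋯`. -/
structure PsiDO.HasTop (P : PsiDO) (m : ℤ) (c₀ c₁ c₂ : ℝ → ℝ) : Prop where
  high : ∀ k, m < k → P k = 0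
  zero : P m = c₀
  one : P (m - 1) = c₁
  two : P (m - 2) = c₂

/-- This is the Leibniz rule cut off after three orders. No differentiability is needed, since
`PsiDO.comp` is defined through `iteratedDeriv` itself. -/
theorem PsiDO.HasTop.comp {P Q : PsiDO} {m n : ℤ} {a₀ a₁ a₂ b₀ b₁ b₂ c₀ c₁ c₂ : ℝ → ℝ}
    (hP : P.HasTop m a₀ a₁ a₂) (hQ : Q.HasTop n b₀ b₁ b₂)
    (h₀ : ∀ x, c₀ x = a₀ x * b₀ x)
    (h₁ : ∀ x, c₁ x = a₀ x * b₁ x + m * a₀ x * deriv b₀ x + a₁ x * b₀ x)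
    (h₂ : ∀ x, c₂ x = a₀ x * b₂ x + m * a₀ x * deriv b₁ x
      + (Ring.choose m 2 : ℤ) * a₀ x * deriv (deriv b₀) x
      + a₁ x * b₁ x + (m - 1) * a₁ x * deriv b₀ x + a₂ x * b₀ x) :
    (P.comp Q).HasTop (m + n) c₀ c₁ c₂ := by
  -- The square of indices also contains pairs with a + l > d; there the coefficient of Q lies above
  -- its order and vanishes.
  have e := fun (j : ℤ) (hj : n < j) (l : ℕ) (x : ℝ) =>
    show iteratedDeriv l (Q j) x = 0 by rw [hQ.high j hj]; simp
  refine ⟨fun k hk => PsiDO.comp_eq_zero hP.high hQ.high k hk, ?_, ?_, ?_⟩ <;> funext x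
  · rw [PsiDO.comp_coeff hP.high hQ.high 0 (by simp), h₀]
    simp [hP.zero, hQ.zero]
  · rw [PsiDO.comp_coeff hP.high hQ.high 1 (by simp), h₁]
    simp only [Finset.sum_range_succ, Finset.sum_range_zero]
    have i2 : n - ((1 : ℕ) : ℤ) + ((0 : ℕ) : ℤ) + ((1 : ℕ) : ℤ) = n := by push_cast; ring
    have i3 : n - ((1 : ℕ) : ℤ) + ((1 : ℕ) : ℤ) + ((0 : ℕ) : ℤ) = n := by push_cast; ring
    rw [e (n - ((1 : ℕ) : ℤ) + ((1 : ℕ) : ℤ) + ((1 : ℕ) : ℤ)) (by push_cast; omega), i2, i3]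
    simp [hP.zero, hQ.zero, hP.one, hQ.one]
  · rw [PsiDO.comp_coeff hP.high hQ.high 2 (by simp), h₂]
    simp only [Finset.sum_range_succ, Finset.sum_range_zero]
    have i1 : n - ((2 : ℕ) : ℤ) + ((0 : ℕ) : ℤ) + ((0 : ℕ) : ℤ) = n - 2 := by push_cast; ring
    have i2 : n - ((2 : ℕ) : ℤ) + ((0 : ℕ) : ℤ) + ((1 : ℕ) : ℤ) = n - 1 := by push_cast; ring
    have i3 : n - ((2 : ℕ) : ℤ) + ((0 : ℕ) : ℤ) + ((2 : ℕ) : ℤ) = n := by push_cast; ring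
    have i4 : n - ((2 : ℕ) : ℤ) + ((1 : ℕ) : ℤ) + ((0 : ℕ) : ℤ) = n - 1 := by push_cast; ring
    have i5 : n - ((2 : ℕ) : ℤ) + ((1 : ℕ) : ℤ) + ((1 : ℕ) : ℤ) = n := by push_cast; ring
    have i6 : n - ((2 : ℕ) : ℤ) + ((2 : ℕ) : ℤ) + ((0 : ℕ) : ℤ) = n := by push_cast; ring
    rw [e (n - ((2 : ℕ) : ℤ) + ((1 : ℕ) : ℤ) + ((2 : ℕ) : ℤ)) (by push_cast; omega),
      e (n - ((2 : ℕ) : ℤ) + ((2 : ℕ) : ℤ) + ((1 : ℕ) : ℤ)) (by push_cast; omega),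
      e (n - ((2 : ℕ) : ℤ) + ((2 : ℕ) : ℤ) + ((2 : ℕ) : ℤ)) (by push_cast; omega),
      i1, i2, i3, i4, i5, i6]
    simp [hP.zero, hQ.zero, hP.one, hQ.one, hP.two, hQ.two, iteratedDeriv_succ]
    ring

theorem PsiDO.hasTop_mul (f : ℝ → ℝ) : (PsiDO.mul f).HasTop 0 f 0 0 := by
  refine ⟨fun k hk => ?_, ?_, ?_, ?_⟩ <;> funext x <;> simp [PsiDO.mul]
  omega

theorem PsiDO.hasTop_partial (m : ℤ) : (PsiDO.partial m).HasTop m 1 0 0 := by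
  refine ⟨fun k hk => ?_, ?_, ?_, ?_⟩ <;> funext x <;> simp [PsiDO.partial]
  omega

theorem PsiDO.hasTop_dressed (m : ℤ) {f : ℝ → ℝ} (hf : ∀ x, f x ≠ 0) :
    (PsiDO.dressed m f).HasTop m 1 (fun x => m * f x * deriv (fun x => (f x)⁻¹) x)
      (fun x => (Ring.choose m 2 : ℤ) * f x * deriv (deriv fun x => (f x)⁻¹) x) := by
  have h1 : ((PsiDO.mul f).comp (PsiDO.partial m)).HasTop (0 + m) f 0 0 :=
    (PsiDO.hasTop_mul f).comp (PsiDO.hasTop_partial m) (by simp)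
      (fun x => by simp)
      (fun x => by simp)
  rw [zero_add] at h1
  have h2 := h1.comp (PsiDO.hasTop_mul fun x => (f x)⁻¹) (c₀ := 1)
    (c₁ := fun x => m * f x * deriv (fun x => (f x)⁻¹) x)
    (c₂ := fun x => (Ring.choose m 2 : ℤ) * f x * deriv (deriv fun x => (f x)⁻¹) x)
    (fun x => by simp [hf x]) (fun x => by simp)
    (fun x => by simp)
  rwa [add_zero] at h2

theorem ring_choose_neg_one_two : Ring.choose (-1 : ℤ) 2 = 1 := by
  have h := Ring.choose_natCast (R := ℤ) 2 2
  have h' := Ring.choose_neg (1 : ℤ) 2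
  norm_num at h h'
  rw [h', h, Int.negOnePow_even 2 even_two, one_smul]

theorem ring_choose_one_two : Ring.choose (1 : ℤ) 2 = 0 := by
  have := Ring.choose_natCast (R := ℤ) 1 2
  simpa using this

variable {f : ℝ → ℝ}

theorem hasDerivAt_inv_of_ne (hf : ∀ x, f x ≠ 0) (hd : Differentiable ℝ f) (x : ℝ) :
    HasDerivAt (fun x => (f x)⁻¹) (-(logDeriv f x * (f x)⁻¹)) x := by
  refine ((hd x).hasDerivAt.fun_inv (hf x)).congr_deriv ?_
  rw [logDeriv_apply]
  field_simp [hf x]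

theorem differentiable_logDeriv (hf : ∀ x, f x ≠ 0) (hd : Differentiable ℝ f)
    (hd2 : Differentiable ℝ (deriv f)) : Differentiable ℝ (logDeriv f) :=
  fun x => (hd2 x).div (hd x) (hf x)

theorem mul_deriv_inv (hf : ∀ x, f x ≠ 0) (hd : Differentiable ℝ f) (x : ℝ) :
    f x * deriv (fun x => (f x)⁻¹) x = -logDeriv f x := by
  rw [(hasDerivAt_inv_of_ne hf hd x).deriv]; field_simp [hf x]

theorem mul_deriv_deriv_inv (hf : ∀ x, f x ≠ 0) (hd : Differentiable ℝ f)
    (hd2 : Differentiable ℝ (deriv f)) (x : ℝ) :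
    f x * deriv (deriv fun x => (f x)⁻¹) x = logDeriv f x ^ 2 - deriv (logDeriv f) x := by
  have h1 : deriv (fun x => (f x)⁻¹) = fun x => -(logDeriv f x * (f x)⁻¹) :=
    funext fun x => (hasDerivAt_inv_of_ne hf hd x).deriv
  rw [h1, (((differentiable_logDeriv hf hd hd2) x).hasDerivAt.fun_mul
    (hasDerivAt_inv_of_ne hf hd x)).fun_neg.deriv]
  field_simp [hf x]
  ring

theorem PsiDO.hasTop_dressed_one (hf : ∀ x, f x ≠ 0) (hd : Differentiable ℝ f) :
    (PsiDO.dressed 1 f).HasTop 1 1 (-logDeriv f) 0 := by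
  convert PsiDO.hasTop_dressed 1 hf using 1
  · funext x
    simpa using (mul_deriv_inv hf hd x).symm
  · funext x
    simp [ring_choose_one_two]

theorem PsiDO.hasTop_dressed_neg_one (hf : ∀ x, f x ≠ 0) (hd : Differentiable ℝ f)
    (hd2 : Differentiable ℝ (deriv f)) :
    (PsiDO.dressed (-1) f).HasTop (-1) 1 (logDeriv f)
      (fun x => logDeriv f x ^ 2 - deriv (logDeriv f) x) := by
  convert PsiDO.hasTop_dressed (-1) hf using 1
  · funext x
    have := mul_deriv_inv hf hd x
    simp only [Int.cast_neg, Int.cast_one, neg_mul, one_mul]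
    linarith
  · funext x
    simpa [ring_choose_neg_one_two] using (mul_deriv_deriv_inv hf hd hd2 x).symm

/-- A differential gauge transformation changes the coefficient of `∂⁻¹` by `(log φ)''`. -/
theorem hasTop_gaugeD {φ u : ℝ → ℝ} {L : PsiDO} (hL : L.HasTop 1 1 0 u) (hφ : ∀ x, φ x ≠ 0)
    (hd : Differentiable ℝ φ) (hd2 : Differentiable ℝ (deriv φ)) :
    (gaugeD φ L).HasTop 1 1 0 (fun x => u x + deriv (logDeriv φ) x) := by
  have h1 := (PsiDO.hasTop_dressed_one hφ hd).comp hL (c₀ := 1) (c₁ := -logDeriv φ) (c₂ := u)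
    (by simp) (by simp) (by simp)
  refine h1.comp (n := -1) (PsiDO.hasTop_dressed_neg_one hφ hd hd2) (by simp)
    (by simp) (fun x => ?_)
  simp
  ring

/-- Conjugation by the inverse of χ ∂ χ⁻¹, hence the opposite sign. With χ = ψ⁻¹ it becomes the
integral gauge transformation, and the sign turns back. -/
theorem hasTop_gaugeD_inv {χ u : ℝ → ℝ} {L : PsiDO} (hL : L.HasTop 1 1 0 u) (hχ : ∀ x, χ x ≠ 0)
    (hd : Differentiable ℝ χ) (hd2 : Differentiable ℝ (deriv χ)) :
    (((PsiDO.dressed (-1) χ).comp L).comp (PsiDO.dressed 1 χ)).HasTop 1 1 0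
      (fun x => u x - deriv (logDeriv χ) x) := by
  have h1 := (PsiDO.hasTop_dressed_neg_one hχ hd hd2).comp hL (c₀ := 1) (c₁ := logDeriv χ)
    (c₂ := fun x => u x + (logDeriv χ x ^ 2 - deriv (logDeriv χ) x))
    (by simp) (by simp) (by simp)
  refine h1.comp (n := 1) (PsiDO.hasTop_dressed_one hχ hd) (by simp)
    (by simp) (fun x => ?_)
  simp
  ring

/-- An integral gauge transformation changes the coefficient of `∂⁻¹` by `(log ψ)''`. -/
theorem hasTop_gaugeI {ψ u : ℝ → ℝ} {L : PsiDO} (hL : L.HasTop 1 1 0 u) (hψ : ∀ x, ψ x ≠ 0)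
    (hd : Differentiable ℝ ψ) (hd2 : Differentiable ℝ (deriv ψ)) :
    (gaugeI ψ L).HasTop 1 1 0 (fun x => u x + deriv (logDeriv ψ) x) := by
  have hl : deriv (fun x => (ψ x)⁻¹) = fun x => -(logDeriv ψ x * (ψ x)⁻¹) :=
    funext fun x => (hasDerivAt_inv_of_ne hψ hd x).deriv
  have hi : Differentiable ℝ fun x => (ψ x)⁻¹ := hd.fun_inv hψ
  have h := hasTop_gaugeD_inv hL (χ := fun x => (ψ x)⁻¹) (fun x => inv_ne_zero (hψ x)) hi (by
    rw [hl]; exact ((differentiable_logDeriv hψ hd hd2).mul hi).neg)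
  have hlog : logDeriv (fun x => (ψ x)⁻¹) = -logDeriv ψ := by
    funext x
    rw [logDeriv_apply, hl]
    simp [hψ x]
  have h' : (fun x => u x + deriv (logDeriv ψ) x) =
      fun x => u x - deriv (logDeriv fun x => (ψ x)⁻¹) x := by
    funext x
    rw [hlog, deriv.neg]
    ring
  rw [h']
  exact h

theorem hasTop_seedLax : seedLax.HasTop 1 1 0 1 := by
  refine ⟨fun k hk => ?_, ?_, ?_, ?_⟩ <;> funext x <;> simp [seedLax, parity_simps]
  omega

end BKP

namespace BKP

open Filter Topology MeasureTheory

/-! ### The chain of four gauge transformations at fixed y and t. -/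

/-- A nonnegative continuous function with a primitive that vanishes at `-∞` is integrable on
left half-lines. -/
theorem integrableOn_Iic_of_nonneg {F h : ℝ → ℝ} (hF : ∀ x, HasDerivAt F (h x) x)
    (h0 : ∀ x, 0 ≤ h x) (hc : Continuous h) (ht : Tendsto F atBot (𝓝 0)) (x : ℝ) :
    IntegrableOn h (Set.Iic x) := by
  refine integrableOn_Iic_of_intervalIntegral_norm_tendsto (a := id) (l := atBot) (F x) x
    (fun i => (hc.integrableOn_Icc (a := i) (b := x)).mono_set Set.Ioc_subset_Icc_self)
    tendsto_id ?_
  have h1 : ∀ i, ∫ s in id i..x, ‖h s‖ = F x - F i := fun i => by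
    simp only [Real.norm_of_nonneg (h0 _)]
    exact intervalIntegral.integral_eq_sub_of_hasDerivAt (fun y _ => hF y)
      (hc.intervalIntegrable _ _)
  simp only [h1]
  simpa using tendsto_const_nhds.sub ht

theorem integral_Iic_of_nonneg {F h : ℝ → ℝ} (hF : ∀ x, HasDerivAt F (h x) x)
    (h0 : ∀ x, 0 ≤ h x) (hc : Continuous h) (ht : Tendsto F atBot (𝓝 0)) (x : ℝ) :
    ∫ s in Set.Iic x, h s = F x := by
  rw [integral_Iic_of_hasDerivAt_of_tendsto' (fun y _ => hF y)
    (integrableOn_Iic_of_nonneg hF h0 hc ht x) ht, sub_zero]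

theorem logDeriv_mul_four {a b c d : ℝ → ℝ} (na : ∀ x, a x ≠ 0) (nb : ∀ x, b x ≠ 0)
    (nc : ∀ x, c x ≠ 0) (nd : ∀ x, d x ≠ 0) (da : Differentiable ℝ a) (db : Differentiable ℝ b)
    (dc : Differentiable ℝ c) (dd : Differentiable ℝ d) (s : ℝ) :
    logDeriv (fun x => a x * b x * c x * d x) s =
      logDeriv a s + logDeriv b s + logDeriv c s + logDeriv d s := by
  rw [logDeriv_mul (f := fun x => a x * b x * c x) (g := d) s
      (mul_ne_zero (mul_ne_zero (na s) (nb s)) (nc s)) (nd s)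
      (((da s).fun_mul (db s)).fun_mul (dc s)) (dd s),
    logDeriv_mul (f := fun x => a x * b x) (g := c) s (mul_ne_zero (na s) (nb s)) (nc s)
      ((da s).fun_mul (db s)) (dc s),
    logDeriv_mul (f := a) (g := b) s (na s) (nb s) (da s) (db s)]

/-- Data for the composed gauge transformation: positive functions `f`, `g` decaying at `-∞`
with `f / g` decreasing, and primitives `A`, `B` of `f g'`, `g f'`. -/
structure GaugeData (f g A B : ℝ → ℝ) : Prop where
  smooth_f : ContDiff ℝ (⊤ : ℕ∞) f
  smooth_g : ContDiff ℝ (⊤ : ℕ∞) g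
  f_pos : ∀ x, 0 < f x
  g_pos : ∀ x, 0 < g x
  deriv_f_pos : ∀ x, 0 < deriv f x
  deriv_g_pos : ∀ x, 0 < deriv g x
  f_tendsto : Tendsto f atBot (𝓝 0)
  g_tendsto : Tendsto g atBot (𝓝 0)
  hasDerivAt_A : ∀ x, HasDerivAt A (f x * deriv g x) x
  hasDerivAt_B : ∀ x, HasDerivAt B (g x * deriv f x) x
  add_eq : ∀ x, A x + B x = f x * g x
  A_nonneg : ∀ x, 0 ≤ A x
  B_nonneg : ∀ x, 0 ≤ B x
  lt : ∀ x, B x < A x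
  wronskian_pos : ∀ x, 0 < f x * deriv g x - g x * deriv f x

namespace GaugeData

variable {f g A B : ℝ → ℝ} (h : GaugeData f g A B)
include h

theorem differentiable_f : Differentiable ℝ f := h.smooth_f.differentiable (by simp)

theorem differentiable_g : Differentiable ℝ g := h.smooth_g.differentiable (by simp)

theorem smooth_deriv_f : ContDiff ℝ (⊤ : ℕ∞) (deriv f) :=
  (contDiff_infty_iff_deriv.1 h.smooth_f).2

theorem smooth_deriv_g : ContDiff ℝ (⊤ : ℕ∞) (deriv g) :=
  (contDiff_infty_iff_deriv.1 h.smooth_g).2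

theorem smooth_A : ContDiff ℝ (⊤ : ℕ∞) A := by
  refine contDiff_infty_iff_deriv.2 ⟨fun x => (h.hasDerivAt_A x).differentiableAt, ?_⟩
  rw [funext fun x => (h.hasDerivAt_A x).deriv]
  exact h.smooth_f.mul h.smooth_deriv_g

theorem smooth_B : ContDiff ℝ (⊤ : ℕ∞) B := by
  refine contDiff_infty_iff_deriv.2 ⟨fun x => (h.hasDerivAt_B x).differentiableAt, ?_⟩
  rw [funext fun x => (h.hasDerivAt_B x).deriv]
  exact h.smooth_g.mul h.smooth_deriv_f

theorem smooth_wronskian :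
    ContDiff ℝ (⊤ : ℕ∞) fun x => f x * deriv g x - g x * deriv f x :=
  (h.smooth_f.mul h.smooth_deriv_g).sub (h.smooth_g.mul h.smooth_deriv_f)

theorem smooth_tau : ContDiff ℝ (⊤ : ℕ∞) fun x => A x - B x := h.smooth_A.sub h.smooth_B

theorem hasDerivAt_tau (x : ℝ) :
    HasDerivAt (fun x => A x - B x) (f x * deriv g x - g x * deriv f x) x :=
  (h.hasDerivAt_A x).sub (h.hasDerivAt_B x)

theorem tau_pos (x : ℝ) : 0 < A x - B x := sub_pos.2 (h.lt x)

theorem fg_tendsto : Tendsto (fun x => f x * g x) atBot (𝓝 0) := by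
  simpa using h.f_tendsto.mul h.g_tendsto

/-- A and B are nonnegative with sum f g, so both are squeezed to zero. This makes them the
primitives that start at -∞. -/
theorem A_tendsto : Tendsto A atBot (𝓝 0) :=
  squeeze_zero h.A_nonneg (fun x => by linarith [h.add_eq x, h.B_nonneg x]) h.fg_tendsto

theorem B_tendsto : Tendsto B atBot (𝓝 0) :=
  squeeze_zero h.B_nonneg (fun x => by linarith [h.add_eq x, h.A_nonneg x]) h.fg_tendsto

theorem tau_tendsto : Tendsto (fun x => A x - B x) atBot (𝓝 0) := by
  simpa using h.A_tendsto.sub h.B_tendsto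

theorem integrableOn_A (x : ℝ) : IntegrableOn (fun s => f s * deriv g s) (Set.Iic x) :=
  integrableOn_Iic_of_nonneg h.hasDerivAt_A
    (fun x => (mul_pos (h.f_pos x) (h.deriv_g_pos x)).le)
    (h.smooth_f.mul h.smooth_deriv_g).continuous h.A_tendsto x

theorem integral_A (x : ℝ) : ∫ s in Set.Iic x, f s * deriv g s = A x :=
  integral_Iic_of_nonneg h.hasDerivAt_A
    (fun x => (mul_pos (h.f_pos x) (h.deriv_g_pos x)).le)
    (h.smooth_f.mul h.smooth_deriv_g).continuous h.A_tendsto x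

theorem integrableOn_B (x : ℝ) : IntegrableOn (fun s => g s * deriv f s) (Set.Iic x) :=
  integrableOn_Iic_of_nonneg h.hasDerivAt_B
    (fun x => (mul_pos (h.g_pos x) (h.deriv_f_pos x)).le)
    (h.smooth_g.mul h.smooth_deriv_f).continuous h.B_tendsto x

theorem integral_B (x : ℝ) : ∫ s in Set.Iic x, g s * deriv f s = B x :=
  integral_Iic_of_nonneg h.hasDerivAt_B
    (fun x => (mul_pos (h.g_pos x) (h.deriv_f_pos x)).le)
    (h.smooth_g.mul h.smooth_deriv_f).continuous h.B_tendsto x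

omit h in
theorem hasDerivAt_sq_half (hf : Differentiable ℝ f) (x : ℝ) :
    HasDerivAt (fun x => f x ^ 2 / 2) (f x * deriv f x) x :=
  (((hf x).hasDerivAt.fun_pow 2).div_const 2).congr_deriv (by simp; ring)

omit h in
theorem sq_half_tendsto (hf : Tendsto f atBot (𝓝 0)) :
    Tendsto (fun x => f x ^ 2 / 2) atBot (𝓝 0) := by
  simpa using (hf.pow 2).div_const 2

theorem integrableOn_ff (x : ℝ) : IntegrableOn (fun s => f s * deriv f s) (Set.Iic x) :=
  integrableOn_Iic_of_nonneg (hasDerivAt_sq_half h.differentiable_f)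
    (fun x => (mul_pos (h.f_pos x) (h.deriv_f_pos x)).le)
    (h.smooth_f.mul h.smooth_deriv_f).continuous (sq_half_tendsto h.f_tendsto) x

theorem integral_ff (x : ℝ) : ∫ s in Set.Iic x, f s * deriv f s = f x ^ 2 / 2 :=
  integral_Iic_of_nonneg (hasDerivAt_sq_half h.differentiable_f)
    (fun x => (mul_pos (h.f_pos x) (h.deriv_f_pos x)).le)
    (h.smooth_f.mul h.smooth_deriv_f).continuous (sq_half_tendsto h.f_tendsto) x

theorem integrableOn_gg (x : ℝ) : IntegrableOn (fun s => g s * deriv g s) (Set.Iic x) :=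
  integrableOn_Iic_of_nonneg (hasDerivAt_sq_half h.differentiable_g)
    (fun x => (mul_pos (h.g_pos x) (h.deriv_g_pos x)).le)
    (h.smooth_g.mul h.smooth_deriv_g).continuous (sq_half_tendsto h.g_tendsto) x

theorem integral_gg (x : ℝ) : ∫ s in Set.Iic x, g s * deriv g s = g x ^ 2 / 2 :=
  integral_Iic_of_nonneg (hasDerivAt_sq_half h.differentiable_g)
    (fun x => (mul_pos (h.g_pos x) (h.deriv_g_pos x)).le)
    (h.smooth_g.mul h.smooth_deriv_g).continuous (sq_half_tendsto h.g_tendsto) x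

theorem hasDerivAt_quotient (x : ℝ) :
    HasDerivAt (fun s => (f s)⁻¹ * g s) ((f x * deriv g x - g x * deriv f x) / f x ^ 2) x := by
  have hf := (h.f_pos x).ne'
  refine (((h.differentiable_f x).hasDerivAt.fun_inv hf).mul
    (h.differentiable_g x).hasDerivAt).congr_deriv ?_
  field_simp
  ring

theorem eigenD_eq : eigenD f g = fun x => (f x * deriv g x - g x * deriv f x) / f x := by
  funext x
  have hf := (h.f_pos x).ne'
  rw [eigenD, (h.hasDerivAt_quotient x).deriv]
  field_simp

theorem conjD_deriv_f : conjD f (deriv f) = fun x => -(f x / 2) := by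
  funext x
  have hf := (h.f_pos x).ne'
  rw [conjD, h.integral_ff]
  field_simp

theorem conjD_deriv_g : conjD f (deriv g) = fun x => -(A x / f x) := by
  funext x
  have hf := (h.f_pos x).ne'
  rw [conjD, h.integral_A]
  field_simp

/-- The factors f cancel in the integrand, leaving -W/2 = -τ'/2. -/
theorem conjD_conjD_deriv_f : conjD (eigenD f g) (conjD f (deriv f)) =
    fun x => f x * (A x - B x) / (2 * (f x * deriv g x - g x * deriv f x)) := by
  funext x
  rw [conjD, h.conjD_deriv_f, h.eigenD_eq]
  have h1 : ∀ s, (f s * deriv g s - g s * deriv f s) / f s * -(f s / 2) =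
      -((f s * deriv g s - g s * deriv f s) / 2) := fun s => by
    have hf := (h.f_pos s).ne'
    field_simp
  simp only [h1, integral_neg]
  rw [integral_Iic_of_nonneg (fun x => (h.hasDerivAt_tau x).div_const 2)
    (fun x => (half_pos (h.wronskian_pos x)).le) (h.smooth_wronskian.continuous.div_const 2)
    (by simpa using h.tau_tendsto.div_const 2)]
  have hf := (h.f_pos x).ne'
  have hw := (h.wronskian_pos x).ne'
  field_simp

theorem conjD_conjD_deriv_g : conjD (eigenD f g) (conjD f (deriv g)) =
    fun x => g x * (A x - B x) / (2 * (f x * deriv g x - g x * deriv f x)) := by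
  funext x
  rw [conjD, h.conjD_deriv_g, h.eigenD_eq]
  have h1 : ∀ s, (f s * deriv g s - g s * deriv f s) / f s * -(A s / f s) =
      -((f s * deriv g s - g s * deriv f s) / f s ^ 2 * A s) := fun s => by
    have hf := (h.f_pos s).ne'
    field_simp
  -- Since (g/f)' = W/f² and τ' = W, the product rule gives (W/f²)(τ + f g)/2, and τ + f g = 2A.
  have hder : ∀ s, HasDerivAt (fun s => (f s)⁻¹ * g s * (A s - B s) / 2)
      ((f s * deriv g s - g s * deriv f s) / f s ^ 2 * A s) s := fun s => by
    have hf := (h.f_pos s).ne'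
    refine (((h.hasDerivAt_quotient s).fun_mul (h.hasDerivAt_tau s)).div_const 2).congr_deriv ?_
    have hB : B s = f s * g s - A s := by linarith [h.add_eq s]
    rw [hB]
    field_simp
    ring
  -- The factor 1/f blows up at -∞, but τ ≤ f g bounds the whole expression by g²/2.
  have ht : Tendsto (fun s => (f s)⁻¹ * g s * (A s - B s) / 2) atBot (𝓝 0) := by
    refine squeeze_zero (fun s => ?_) (fun s => ?_) (sq_half_tendsto h.g_tendsto)
    · have := h.f_pos s
      have := h.g_pos s
      have := h.tau_pos s
      positivity
    · have hf := h.f_pos s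
      have hle : A s - B s ≤ f s * g s := by linarith [h.add_eq s, h.B_nonneg s]
      have hg := h.g_pos s
      have : (f s)⁻¹ * g s * (A s - B s) ≤ (f s)⁻¹ * g s * (f s * g s) := by gcongr
      have e : (f s)⁻¹ * g s * (f s * g s) = g s ^ 2 := by field_simp
      rw [e] at this
      linarith
  simp only [h1, integral_neg]
  rw [integral_Iic_of_nonneg hder
    (fun s => mul_nonneg (div_nonneg (h.wronskian_pos s).le (sq_nonneg _)) (h.A_nonneg s))
    ((h.smooth_wronskian.continuous.div (h.smooth_f.continuous.pow 2)
      (fun s => pow_ne_zero 2 (h.f_pos s).ne')).mul h.smooth_A.continuous) ht]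
  have hf := (h.f_pos x).ne'
  have hw := (h.wronskian_pos x).ne'
  field_simp

/-- The two transformed conjugate eigenfunctions share the factor τ/(2W), so their quotient is g/f,
with derivative W/f². -/
theorem conjI_eq : conjI (conjD (eigenD f g) (conjD f (deriv f)))
    (conjD (eigenD f g) (conjD f (deriv g))) = fun x => -((A x - B x) / (2 * f x)) := by
  funext x
  rw [conjI, h.conjD_conjD_deriv_f, h.conjD_conjD_deriv_g]
  have h1 : (fun s => (f s * (A s - B s) / (2 * (f s * deriv g s - g s * deriv f s)))⁻¹ *
      (g s * (A s - B s) / (2 * (f s * deriv g s - g s * deriv f s)))) =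
      fun s => (f s)⁻¹ * g s := by
    funext s
    have hf := (h.f_pos s).ne'
    have hw := (h.wronskian_pos s).ne'
    have ht := (h.tau_pos s).ne'
    field_simp
  rw [h1, (h.hasDerivAt_quotient x).deriv]
  have hf := (h.f_pos x).ne'
  have hw := (h.wronskian_pos x).ne'
  field_simp

/-- The coefficient of `∂⁻¹` after the four gauge transformations. -/
theorem gauge22_seedLax (x : ℝ) :
    gauge22 f g (deriv f) (deriv g) seedLax (-1) x =
      1 + deriv (deriv fun s => Real.log |-((A s - B s) ^ 2 / 4)|) x := by
  have key : ∀ {χ : ℝ → ℝ}, ContDiff ℝ (⊤ : ℕ∞) χ →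
      Differentiable ℝ χ ∧ Differentiable ℝ (deriv χ) := fun hχ =>
    ⟨hχ.differentiable (by simp),
      (contDiff_infty_iff_deriv.1 hχ).2.differentiable (by simp)⟩
  have n1 : ∀ x, f x ≠ 0 := fun x => (h.f_pos x).ne'
  have nw : ∀ x, f x * deriv g x - g x * deriv f x ≠ 0 := fun x => (h.wronskian_pos x).ne'
  have nt : ∀ x, A x - B x ≠ 0 := fun x => (h.tau_pos x).ne'
  obtain ⟨d1, d1'⟩ := key h.smooth_f
  obtain ⟨d2, d2'⟩ := key
    (χ := fun x => (f x * deriv g x - g x * deriv f x) / f x) (h.smooth_wronskian.div h.smooth_f n1)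
  obtain ⟨d3, d3'⟩ := key
    (χ := fun x => f x * (A x - B x) / (2 * (f x * deriv g x - g x * deriv f x)))
    ((h.smooth_f.mul h.smooth_tau).div
    (contDiff_const.mul h.smooth_wronskian) (fun x => mul_ne_zero two_ne_zero (nw x)))
  obtain ⟨d4, d4'⟩ := key (χ := fun x => -((A x - B x) / (2 * f x))) (h.smooth_tau.div
    (contDiff_const.mul h.smooth_f) (fun x => mul_ne_zero two_ne_zero (n1 x))).neg
  have n2 : ∀ x, (f x * deriv g x - g x * deriv f x) / f x ≠ 0 := fun x =>
    div_ne_zero (nw x) (n1 x)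
  have n3 : ∀ x, f x * (A x - B x) / (2 * (f x * deriv g x - g x * deriv f x)) ≠ 0 := fun x =>
    div_ne_zero (mul_ne_zero (n1 x) (nt x)) (mul_ne_zero two_ne_zero (nw x))
  have n4 : ∀ x, -((A x - B x) / (2 * f x)) ≠ 0 := fun x =>
    neg_ne_zero.2 (div_ne_zero (nt x) (mul_ne_zero two_ne_zero (n1 x)))
  have hG := hasTop_gaugeI (hasTop_gaugeI (hasTop_gaugeD (hasTop_gaugeD hasTop_seedLax
    n1 d1 d1') n2 d2 d2') n3 d3 d3') n4 d4 d4'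
  have hlog : (deriv fun s => Real.log |-((A s - B s) ^ 2 / 4)|) = fun s =>
      logDeriv f s + logDeriv (fun x => (f x * deriv g x - g x * deriv f x) / f x) s
      + logDeriv (fun x => f x * (A x - B x) / (2 * (f x * deriv g x - g x * deriv f x))) s
      + logDeriv (fun x => -((A x - B x) / (2 * f x))) s := by
    funext s
    rw [← logDeriv_mul_four n1 n2 n3 n4 d1 d2 d3 d4]
    -- The product of the four generating functions telescopes: W and f cancel.
    have e : (fun x => f x * ((f x * deriv g x - g x * deriv f x) / f x) *
        (f x * (A x - B x) / (2 * (f x * deriv g x - g x * deriv f x))) *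
        -((A x - B x) / (2 * f x))) = fun x => -((A x - B x) ^ 2 / 4) := by
      funext x
      have := n1 x
      have := nw x
      field_simp
      ring
    rw [e]
    simp only [Real.log_abs]
    rw [deriv.log, logDeriv_apply]
    · exact (((h.hasDerivAt_tau s).differentiableAt.pow 2).div_const 4).neg
    · exact neg_ne_zero.2 (div_ne_zero (pow_ne_zero 2 (nt s)) four_ne_zero)
  have hl := fun {χ : ℝ → ℝ} (n : ∀ x, χ x ≠ 0) (d : Differentiable ℝ χ)
    (d' : Differentiable ℝ (deriv χ)) => differentiable_logDeriv n d d'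
  have hsum := ((((hl n1 d1 d1' x).hasDerivAt.fun_add (hl n2 d2 d2' x).hasDerivAt).fun_add
    (hl n3 d3 d3' x).hasDerivAt).fun_add (hl n4 d4 d4' x).hasDerivAt).deriv
  rw [hlog, hsum]
  have := congrFun hG.two x
  change gaugeI (conjI (conjD (eigenD f g) (conjD f (deriv f)))
    (conjD (eigenD f g) (conjD f (deriv g)))) (gaugeI (conjD (eigenD f g) (conjD f (deriv f)))
    (gaugeD (eigenD f g) (gaugeD f seedLax))) (-1) x = _
  rw [h.conjI_eq, h.conjD_conjD_deriv_f, h.eigenD_eq]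
  refine this.trans ?_
  simp only [Pi.one_apply]
  ring

end GaugeData

end BKP

namespace BKP

/-! ### The bilinear equation in a differential algebra -/

section Bilinear

variable {R : Type*} [CommRing R] [Algebra ℝ R] (X Y T : Derivation ℝ R R)

theorem derivation_ofNat (D : Derivation ℝ R R) (n : ℕ) [n.AtLeastTwo] :
    D ofNat(n) = 0 := by
  rw [← Nat.cast_ofNat, D.map_natCast]

/-- Half of the Hirota form `(9 DₓDₜ - 5 D_y² - 45 Dₓ² + Dₓ⁶ + 15 Dₓ⁴ - 5 Dₓ³D_y - 15 DₓD_y) τ·τ`. -/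
def hirota (τ : R) : R :=
  9 * (τ * X (T τ) - X τ * T τ) - 5 * (τ * Y (Y τ) - Y τ * Y τ) - 45 * (τ * X (X τ) - X τ * X τ)
    + (τ * X (X (X (X (X (X τ))))) - 6 * (X τ * X (X (X (X (X τ)))))
      + 15 * (X (X τ) * X (X (X (X τ)))) - 10 * (X (X (X τ)) * X (X (X τ))))
    + 15 * (τ * X (X (X (X τ))) - 4 * (X τ * X (X (X τ))) + 3 * (X (X τ) * X (X τ)))
    - 5 * (τ * X (X (X (Y τ))) - 3 * (X τ * X (X (Y τ))) + 3 * (X (X τ) * X (Y τ))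
      - X (X (X τ)) * Y τ)
    - 15 * (τ * X (Y τ) - X τ * Y τ)

/-- The Hirota form of `τ`, divided by `τ²`, in terms of the logarithm `L` of `τ`. -/
theorem hirota_eq_of_log {L τ : R} (hX : X τ = X L * τ) (hY : Y τ = Y L * τ)
    (hT : T τ = T L * τ) :
    hirota X Y T τ = τ ^ 2 * (9 * X (T L) - 5 * Y (Y L) - 45 * X (X L)
      + (X (X (X (X (X (X L))))) + 30 * X (X L) * X (X (X (X L))) + 60 * X (X L) ^ 3)
      + 15 * (X (X (X (X L))) + 6 * X (X L) ^ 2)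
      - 5 * (X (X (X (Y L))) + 6 * X (X L) * X (Y L)) - 15 * X (Y L)) := by
  -- The hypotheses say that τ behaves like exp L, so each derivative of τ is τ times a complete
  -- Bell polynomial in the derivatives of L. In the Hirota form the first derivatives of L cancel.
  have h2 : X (X τ) = (X (X L) + X L ^ 2) * τ := by
    rw [hX]
    simp [Derivation.leibniz, hX]
    ring
  have h3 : X (X (X τ)) = (X (X (X L)) + 3 * X L * X (X L) + X L ^ 3) * τ := by
    rw [h2]
    simp [Derivation.leibniz, Derivation.leibniz_pow, hX]
    ring
  have h4 : X (X (X (X τ))) = (X (X (X (X L))) + 4 * X L * X (X (X L)) + 3 * X (X L) ^ 2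
      + 6 * X L ^ 2 * X (X L) + X L ^ 4) * τ := by
    rw [h3]
    simp [Derivation.leibniz, Derivation.leibniz_pow, derivation_ofNat, hX]
    ring
  have h5 : X (X (X (X (X τ)))) = (X (X (X (X (X L)))) + 5 * X L * X (X (X (X L)))
      + 10 * X (X L) * X (X (X L)) + 10 * X L ^ 2 * X (X (X L)) + 15 * X L * X (X L) ^ 2
      + 10 * X L ^ 3 * X (X L) + X L ^ 5) * τ := by
    rw [h4]
    simp [Derivation.leibniz, Derivation.leibniz_pow, derivation_ofNat, hX]
    ring
  have h6 : X (X (X (X (X (X τ))))) = (X (X (X (X (X (X L))))) + 6 * X L * X (X (X (X (X L))))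
      + 15 * X (X L) * X (X (X (X L))) + 10 * X (X (X L)) ^ 2 + 15 * X L ^ 2 * X (X (X (X L)))
      + 60 * X L * X (X L) * X (X (X L)) + 15 * X (X L) ^ 3 + 20 * X L ^ 3 * X (X (X L))
      + 45 * X L ^ 2 * X (X L) ^ 2 + 15 * X L ^ 4 * X (X L) + X L ^ 6) * τ := by
    rw [h5]
    simp [Derivation.leibniz, Derivation.leibniz_pow, derivation_ofNat, hX]
    ring
  have hXY : X (Y τ) = (X (Y L) + X L * Y L) * τ := by
    rw [hY]
    simp [Derivation.leibniz, hX]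
    ring
  have hXXY : X (X (Y τ)) = (X (X (Y L)) + X (X L) * Y L + 2 * X L * X (Y L)
      + X L ^ 2 * Y L) * τ := by
    rw [hXY]
    simp [Derivation.leibniz, hX]
    ring
  have hXXXY : X (X (X (Y τ))) = (X (X (X (Y L))) + X (X (X L)) * Y L + 3 * X (X L) * X (Y L)
      + 3 * X L * X (X (Y L)) + 3 * X L * X (X L) * Y L + 3 * X L ^ 2 * X (Y L)
      + X L ^ 3 * Y L) * τ := by
    rw [hXXY]
    simp [Derivation.leibniz, Derivation.leibniz_pow, derivation_ofNat, hX]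
    ring
  have hYY : Y (Y τ) = (Y (Y L) + Y L ^ 2) * τ := by
    rw [hY]
    simp [Derivation.leibniz, hY]
    ring
  have hXT : X (T τ) = (X (T L) + X L * T L) * τ := by
    rw [hT]
    simp [Derivation.leibniz, hX]
    ring
  rw [hirota, h6, h5, h4, h3, h2, hXXXY, hXXY, hXY, hYY, hXT, hX, hY, hT]
  ring

/-- The bilinear equation for `τ` gives the Sawada–Kotera equation for `1 + 2 (log τ)ₓₓ`. -/
theorem sawadaKotera_of_hirota (hXY : ∀ f, Y (X f) = X (Y f)) (hXT : ∀ f, T (X f) = X (T f))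
    {L τ : R} (hτ : IsUnit τ) (hX : X τ = X L * τ) (hY : Y τ = Y L * τ) (hT : T τ = T L * τ)
    (hB : hirota X Y T τ = 0) {u v : R} (hu : u = 1 + 2 * X (X L)) (hv : v = 6 + 2 * X (Y L)) :
    9 * T u = 5 * Y v + 15 * X u * v - X (X (X (X (X u)))) - 15 * u * X (X (X u))
      - 15 * X u * X (X u) - 45 * u ^ 2 * X u + 5 * Y (X (X u)) + 15 * u * Y u := by
  rw [hirota_eq_of_log X Y T hX hY hT, (hτ.pow 2).mul_right_eq_zero] at hB
  have h2 : ∀ (D : Derivation ℝ R R) (a : R), D (2 * a) = 2 * D a := fun D a => by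
    simp [Derivation.leibniz, derivation_ofNat]
  have hB' := congrArg X hB
  simp only [map_add, map_sub, map_zero, Derivation.leibniz, Derivation.leibniz_pow, smul_eq_mul,
    nsmul_eq_mul, derivation_ofNat] at hB'
  subst hu hv
  simp only [map_add, h2, derivation_ofNat, Derivation.map_one_eq_zero, hXY, hXT, zero_add]
  push_cast at hB'
  -- The background values u = 1 and v = 6 produce the lower-order terms -45 Dₓ², 15 Dₓ⁴ and -15
  -- DₓD_y of the bilinear form.
  linear_combination 2 * hB'

end Bilinear

/-! ### Exponential solutions of the bilinear equation -/

section Exponential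

variable {ι κ : Type*} [Fintype ι] [Fintype κ]

/-- A fourfold sum vanishes if its symmetrization does. -/
theorem sum_eq_zero_of_symmetrized (F : ι × κ → ι × κ → ℝ)
    (h : ∀ i j i' j', F (i, j) (i', j') + F (i, j') (i', j) + F (i', j') (i, j)
      + F (i', j) (i, j') = 0) : ∑ m, ∑ m', F m m' = 0 := by
  have hsum : ∑ m, ∑ m', F m m' = ∑ q : (ι × κ) × (ι × κ), F q.1 q.2 :=
    (Fintype.sum_prod_type' F).symm
  -- Exchanging the κ-indices and exchanging the two pairs generate a Klein four-group acting on the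
  -- quadruples. The sum is invariant under it, so four times the sum is the symmetrized one.
  let swap : (ι × κ) × (ι × κ) ≃ (ι × κ) × (ι × κ) :=
    ⟨fun q => ((q.1.1, q.2.2), (q.2.1, q.1.2)), fun q => ((q.1.1, q.2.2), (q.2.1, q.1.2)),
      fun _ => rfl, fun _ => rfl⟩
  have e1 := swap.sum_comp fun q => F q.1 q.2
  have e2 := (Equiv.prodComm (ι × κ) (ι × κ)).sum_comp fun q => F q.1 q.2
  have e3 := (swap.trans (Equiv.prodComm (ι × κ) (ι × κ))).sum_comp fun q => F q.1 q.2
  have key : ∑ q : (ι × κ) × (ι × κ), (F q.1 q.2 + F (swap q).1 (swap q).2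
      + F (Equiv.prodComm (ι × κ) (ι × κ) q).1 (Equiv.prodComm (ι × κ) (ι × κ) q).2
      + F ((swap.trans (Equiv.prodComm (ι × κ) (ι × κ))) q).1
        ((swap.trans (Equiv.prodComm (ι × κ) (ι × κ))) q).2) = 0 :=
    Finset.sum_eq_zero fun q _ => h q.1.1 q.1.2 q.2.1 q.2.2
  simp only [Finset.sum_add_distrib] at key
  rw [hsum]
  linarith [e1, e2, e3, key]

/-- The dispersion polynomial of the Hirota form. -/
def hirotaSymbol (p q r : ℝ) : ℝ :=
  9 * p * r - 5 * q ^ 2 - 45 * p ^ 2 + p ^ 6 + 15 * p ^ 4 - 5 * p ^ 3 * q - 15 * p * q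

/-- The `y`-exponent of a solution with `x`-exponent `a`. -/
def yExponent (a : ℝ) : ℝ := a ^ 3 + 3 * a

/-- The `t`-exponent of a solution with `x`-exponent `a`. -/
def tExponent (a : ℝ) : ℝ := a ^ 5 + 5 * a ^ 3 + 15 * a

/-- Two wave numbers p, q of the first family and r, s of the second can be paired in two ways, with
the same total exponential. The identity says that the contributions of the two pairings cancel. -/
theorem hirotaSymbol_four {p q r s : ℝ} (hpr : r + p ≠ 0) (hps : s + p ≠ 0)
    (hqr : r + q ≠ 0) (hqs : s + q ≠ 0) :
    (r - p) / (r + p) * ((s - q) / (s + q)) * hirotaSymbol (p + r - q - s)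
      (yExponent p + yExponent r - yExponent q - yExponent s)
      (tExponent p + tExponent r - tExponent q - tExponent s) +
    (s - p) / (s + p) * ((r - q) / (r + q)) * hirotaSymbol (p + s - q - r)
      (yExponent p + yExponent s - yExponent q - yExponent r)
      (tExponent p + tExponent s - tExponent q - tExponent r) = 0 := by
  unfold hirotaSymbol yExponent tExponent
  field_simp
  ring

/-- The Hirota form in terms of the values of the derivatives of an exponential sum. -/
theorem hirota_sum {μ : Type*} [Fintype μ] (w p q r : μ → ℝ) (S : ℕ → ℕ → ℕ → ℝ)
    (hS : ∀ a b c, S a b c = ∑ m, w m * (p m ^ a * q m ^ b * r m ^ c)) :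
    9 * (S 0 0 0 * S 1 0 1 - S 1 0 0 * S 0 0 1) - 5 * (S 0 0 0 * S 0 2 0 - S 0 1 0 * S 0 1 0)
      - 45 * (S 0 0 0 * S 2 0 0 - S 1 0 0 * S 1 0 0)
      + (S 0 0 0 * S 6 0 0 - 6 * (S 1 0 0 * S 5 0 0) + 15 * (S 2 0 0 * S 4 0 0)
        - 10 * (S 3 0 0 * S 3 0 0))
      + 15 * (S 0 0 0 * S 4 0 0 - 4 * (S 1 0 0 * S 3 0 0) + 3 * (S 2 0 0 * S 2 0 0))
      - 5 * (S 0 0 0 * S 3 1 0 - 3 * (S 1 0 0 * S 2 1 0) + 3 * (S 2 0 0 * S 1 1 0)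
        - S 3 0 0 * S 0 1 0)
      - 15 * (S 0 0 0 * S 1 1 0 - S 1 0 0 * S 0 1 0) =
    ∑ m, ∑ m', w m * w m' * (9 * (p m' * r m' - p m * r m')
      - 5 * (q m' ^ 2 - q m * q m') - 45 * (p m' ^ 2 - p m * p m')
      + (p m' ^ 6 - 6 * (p m * p m' ^ 5) + 15 * (p m ^ 2 * p m' ^ 4) - 10 * (p m ^ 3 * p m' ^ 3))
      + 15 * (p m' ^ 4 - 4 * (p m * p m' ^ 3) + 3 * (p m ^ 2 * p m' ^ 2))
      - 5 * (p m' ^ 3 * q m' - 3 * (p m * (p m' ^ 2 * q m')) + 3 * (p m ^ 2 * (p m' * q m'))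
        - p m ^ 3 * q m')
      - 15 * (p m' * q m' - p m * q m')) := by
  simp only [hS, Finset.sum_mul_sum]
  simp only [Finset.mul_sum, ← Finset.sum_add_distrib, ← Finset.sum_sub_distrib]
  refine Finset.sum_congr rfl fun m _ => Finset.sum_congr rfl fun m' _ => ?_
  ring

theorem hirota_exponential (K P : ι → ℝ) (M Q : κ → ℝ) (hPQ : ∀ i j, Q j + P i ≠ 0)
    (w p q r : ι × κ → ℝ)
    (hw : ∀ m, w m = K m.1 * M m.2 * ((Q m.2 - P m.1) / (Q m.2 + P m.1)))
    (hp : ∀ m, p m = P m.1 + Q m.2) (hq : ∀ m, q m = yExponent (P m.1) + yExponent (Q m.2))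
    (hr : ∀ m, r m = tExponent (P m.1) + tExponent (Q m.2)) (S : ℕ → ℕ → ℕ → ℝ)
    (hS : ∀ a b c, S a b c = ∑ m, w m * (p m ^ a * q m ^ b * r m ^ c)) :
    9 * (S 0 0 0 * S 1 0 1 - S 1 0 0 * S 0 0 1) - 5 * (S 0 0 0 * S 0 2 0 - S 0 1 0 * S 0 1 0)
      - 45 * (S 0 0 0 * S 2 0 0 - S 1 0 0 * S 1 0 0)
      + (S 0 0 0 * S 6 0 0 - 6 * (S 1 0 0 * S 5 0 0) + 15 * (S 2 0 0 * S 4 0 0)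
        - 10 * (S 3 0 0 * S 3 0 0))
      + 15 * (S 0 0 0 * S 4 0 0 - 4 * (S 1 0 0 * S 3 0 0) + 3 * (S 2 0 0 * S 2 0 0))
      - 5 * (S 0 0 0 * S 3 1 0 - 3 * (S 1 0 0 * S 2 1 0) + 3 * (S 2 0 0 * S 1 1 0)
        - S 3 0 0 * S 0 1 0)
      - 15 * (S 0 0 0 * S 1 1 0 - S 1 0 0 * S 0 1 0) = 0 := by
  rw [hirota_sum w p q r S hS]
  refine sum_eq_zero_of_symmetrized _ fun i j i' j' => ?_
  have h := hirotaSymbol_four (hPQ i j) (hPQ i j') (hPQ i' j) (hPQ i' j')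
  simp only [hw, hp, hq, hr]
  unfold hirotaSymbol at h
  -- With fractions and exponents as atoms, the goal is polynomial. Exchanging the two pairs turns
  -- the half form into the full symbol of the exponent differences, which is even, so their sign is
  -- irrelevant.
  generalize (Q j - P i) / (Q j + P i) = c₁ at h ⊢
  generalize (Q j' - P i') / (Q j' + P i') = c₂ at h ⊢
  generalize (Q j' - P i) / (Q j' + P i) = c₃ at h ⊢
  generalize (Q j - P i') / (Q j + P i') = c₄ at h ⊢
  generalize yExponent (P i) = y₁ at h ⊢
  generalize yExponent (P i') = y₂ at h ⊢
  generalize yExponent (Q j) = y₃ at h ⊢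
  generalize yExponent (Q j') = y₄ at h ⊢
  generalize tExponent (P i) = t₁ at h ⊢
  generalize tExponent (P i') = t₂ at h ⊢
  generalize tExponent (Q j) = t₃ at h ⊢
  generalize tExponent (Q j') = t₄ at h ⊢
  linear_combination K i * K i' * M j * M j' * h

end Exponential

end BKP

namespace BKP

noncomputable section

/-! ### The differential algebra of smooth functions -/

/-- The algebra of smooth functions of three variables. -/
def smoothFun : Subalgebra ℝ Fun3 where
  carrier := {f | IsSmooth f}
  mul_mem' {f g} (hf : IsSmooth f) (hg : IsSmooth g) :=
    show IsSmooth (f * g) from ContDiff.mul hf hg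
  add_mem' {f g} (hf : IsSmooth f) (hg : IsSmooth g) :=
    show IsSmooth (f + g) from ContDiff.add hf hg
  algebraMap_mem' c := show IsSmooth (fun _ _ _ => c) from contDiff_const

/-- A function of three variables as a function of a point. -/
def uncurry3 (f : Fun3) (p : ℝ × ℝ × ℝ) : ℝ := f p.1 p.2.1 p.2.2

theorem contDiff_uncurry3 (f : smoothFun) : ContDiff ℝ (⊤ : ℕ∞) (uncurry3 f) := f.2

theorem differentiableAt_uncurry3 (f : smoothFun) (p : ℝ × ℝ × ℝ) :
    DifferentiableAt ℝ (uncurry3 f) p :=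
  (contDiff_uncurry3 f).differentiable (by simp) p

theorem contDiff_dirDeriv (f : smoothFun) (v : ℝ × ℝ × ℝ) :
    ContDiff ℝ (⊤ : ℕ∞) fun p => fderiv ℝ (uncurry3 f) p v :=
  ((contDiff_uncurry3 f).fderiv_right (by simp)).clm_apply contDiff_const

/-- The derivative in the direction `v`. -/
def dirDeriv (v : ℝ × ℝ × ℝ) : Derivation ℝ smoothFun smoothFun :=
  Derivation.mk'
    { toFun := fun f => ⟨fun x y t => fderiv ℝ (uncurry3 f) (x, y, t) v, contDiff_dirDeriv f v⟩
      map_add' := fun f g => by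
        refine Subtype.ext (funext fun x => funext fun y => funext fun t => ?_)
        have h := fderiv_add (differentiableAt_uncurry3 f (x, y, t))
          (differentiableAt_uncurry3 g (x, y, t))
        exact congrArg (fun F => F v) h
      map_smul' := fun c f => by
        refine Subtype.ext (funext fun x => funext fun y => funext fun t => ?_)
        have h := fderiv_const_smul (differentiableAt_uncurry3 f (x, y, t)) c
        exact congrArg (fun F => F v) h }
    (fun f g => by
      refine Subtype.ext (funext fun x => funext fun y => funext fun t => ?_)
      have h := fderiv_mul (differentiableAt_uncurry3 f (x, y, t))
          (differentiableAt_uncurry3 g (x, y, t))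
      exact congrArg (fun F => F v) h)

theorem dirDeriv_apply (v : ℝ × ℝ × ℝ) (f : smoothFun) (x y t : ℝ) :
    (dirDeriv v f : Fun3) x y t = fderiv ℝ (uncurry3 f) (x, y, t) v := rfl

/-- Symmetry of the second Fréchet derivative; it supplies the commutation assumed in
`sawadaKotera_of_hirota`. -/
theorem dirDeriv_comm (v w : ℝ × ℝ × ℝ) (f : smoothFun) :
    dirDeriv v (dirDeriv w f) = dirDeriv w (dirDeriv v f) := by
  refine Subtype.ext (funext fun x => funext fun y => funext fun t => ?_)
  have hd : DifferentiableAt ℝ (fderiv ℝ (uncurry3 f)) (x, y, t) :=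
    ((contDiff_uncurry3 f).fderiv_right (m := 1) (by norm_cast)).differentiable (by simp) _
  have h2 : ∀ a b, (dirDeriv a (dirDeriv b f) : Fun3) x y t =
      fderiv ℝ (fderiv ℝ (uncurry3 f)) (x, y, t) a b := fun a b => by
    rw [dirDeriv_apply]
    change fderiv ℝ (fun p => fderiv ℝ (uncurry3 f) p b) (x, y, t) a = _
    rw [fderiv_clm_apply hd (differentiableAt_const b)]
    simp
  rw [h2, h2]
  exact ((contDiff_uncurry3 f).contDiffAt.isSymmSndFDerivAt
    (by simp only [minSmoothness_of_isRCLikeNormedField]; norm_cast)) v w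

abbrev Dx : Derivation ℝ smoothFun smoothFun := dirDeriv (1, 0, 0)

abbrev Dy : Derivation ℝ smoothFun smoothFun := dirDeriv (0, 1, 0)

abbrev Dt : Derivation ℝ smoothFun smoothFun := dirDeriv (0, 0, 1)

theorem dx_coe (f : smoothFun) : dx f = Dx f := by
  funext x y t
  have h : HasDerivAt (fun s : ℝ => ((s, y, t) : ℝ × ℝ × ℝ)) (1, 0, 0) x :=
    (hasDerivAt_id x).prodMk ((hasDerivAt_const x y).prodMk (hasDerivAt_const x t))
  exact ((differentiableAt_uncurry3 f (x, y, t)).hasFDerivAt.comp_hasDerivAt x h).deriv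

theorem dy_coe (f : smoothFun) : dy f = Dy f := by
  funext x y t
  have h : HasDerivAt (fun s : ℝ => ((x, s, t) : ℝ × ℝ × ℝ)) (0, 1, 0) y :=
    (hasDerivAt_const y x).prodMk ((hasDerivAt_id y).prodMk (hasDerivAt_const y t))
  exact ((differentiableAt_uncurry3 f (x, y, t)).hasFDerivAt.comp_hasDerivAt y h).deriv

theorem dt_coe (f : smoothFun) : dt f = Dt f := by
  funext x y t
  have h : HasDerivAt (fun s : ℝ => ((x, y, s) : ℝ × ℝ × ℝ)) (0, 0, 1) t :=
    (hasDerivAt_const t x).prodMk ((hasDerivAt_const t y).prodMk (hasDerivAt_id t))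
  exact ((differentiableAt_uncurry3 f (x, y, t)).hasFDerivAt.comp_hasDerivAt t h).deriv

/-! ### Exponential sums -/

/-- The function `exp (p x + q y + r t)`. -/
def expFun (p q r : ℝ) : smoothFun :=
  ⟨fun x y t => Real.exp (p * x + q * y + r * t), by
    change ContDiff ℝ (⊤ : ℕ∞) fun z : ℝ × ℝ × ℝ => Real.exp (p * z.1 + q * z.2.1 + r * z.2.2)
    fun_prop⟩

theorem Dx_expFun (p q r : ℝ) : Dx (expFun p q r) = p • expFun p q r := by
  refine Subtype.ext ((dx_coe _).symm.trans (funext fun x => funext fun y => funext fun t => ?_))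
  have h : HasDerivAt (fun s => p * s + q * y + r * t) p x := by
    simpa using (((hasDerivAt_id x).const_mul p).add_const (q * y)).add_const (r * t)
  exact h.exp.deriv.trans (mul_comm _ _)

theorem Dy_expFun (p q r : ℝ) : Dy (expFun p q r) = q • expFun p q r := by
  refine Subtype.ext ((dy_coe _).symm.trans (funext fun x => funext fun y => funext fun t => ?_))
  have h : HasDerivAt (fun s => p * x + q * s + r * t) q y := by
    simpa using (((hasDerivAt_id y).const_mul q).const_add (p * x)).add_const (r * t)
  exact h.exp.deriv.trans (mul_comm _ _)

theorem Dt_expFun (p q r : ℝ) : Dt (expFun p q r) = r • expFun p q r := by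
  refine Subtype.ext ((dt_coe _).symm.trans (funext fun x => funext fun y => funext fun t => ?_))
  have h : HasDerivAt (fun s => p * x + q * y + r * s) r t := by
    simpa using ((hasDerivAt_id t).const_mul r).const_add (p * x + q * y)
  exact h.exp.deriv.trans (mul_comm _ _)

variable {μ : Type*} [Fintype μ]

/-- The exponential sum `∑ₘ wₘ exp (pₘ x + qₘ y + rₘ t)`. -/
def expComb (w p q r : μ → ℝ) : smoothFun := ∑ m, w m • expFun (p m) (q m) (r m)

theorem Dx_expComb (w p q r : μ → ℝ) :
    Dx (expComb w p q r) = expComb (fun m => w m * p m) p q r := by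
  simp only [expComb, map_sum, Derivation.map_smul, Dx_expFun, smul_smul]

theorem Dy_expComb (w p q r : μ → ℝ) :
    Dy (expComb w p q r) = expComb (fun m => w m * q m) p q r := by
  simp only [expComb, map_sum, Derivation.map_smul, Dy_expFun, smul_smul]

theorem Dt_expComb (w p q r : μ → ℝ) :
    Dt (expComb w p q r) = expComb (fun m => w m * r m) p q r := by
  simp only [expComb, map_sum, Derivation.map_smul, Dt_expFun, smul_smul]

/-- Evaluation at a point. -/
def evalAt (x y t : ℝ) : smoothFun →ₐ[ℝ] ℝ :=
  AlgHom.comp (Pi.evalAlgHom ℝ (fun _ : ℝ => ℝ) t) <|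
    AlgHom.comp (Pi.evalAlgHom ℝ (fun _ : ℝ => ℝ → ℝ) y) <|
      AlgHom.comp (Pi.evalAlgHom ℝ (fun _ : ℝ => ℝ → ℝ → ℝ) x) smoothFun.val

theorem evalAt_apply (x y t : ℝ) (f : smoothFun) : evalAt x y t f = (f : Fun3) x y t := rfl

theorem evalAt_expComb (w p q r : μ → ℝ) (x y t : ℝ) :
    evalAt x y t (expComb w p q r) =
      ∑ m, w m * Real.exp (p m * x + q m * y + r m * t) := by
  simp only [expComb, map_sum, map_smul, smul_eq_mul]
  rfl

theorem expComb_apply (w p q r : μ → ℝ) (x y t : ℝ) :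
    (expComb w p q r : Fun3) x y t = ∑ m, w m * Real.exp (p m * x + q m * y + r m * t) :=
  evalAt_expComb w p q r x y t

theorem hirota_expComb {ι κ : Type*} [Fintype ι] [Fintype κ] (K P : ι → ℝ) (M Q : κ → ℝ)
    (hPQ : ∀ i j, Q j + P i ≠ 0) (w p q r : ι × κ → ℝ)
    (hw : ∀ m, w m = K m.1 * M m.2 * ((Q m.2 - P m.1) / (Q m.2 + P m.1)))
    (hp : ∀ m, p m = P m.1 + Q m.2) (hq : ∀ m, q m = yExponent (P m.1) + yExponent (Q m.2))
    (hr : ∀ m, r m = tExponent (P m.1) + tExponent (Q m.2)) :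
    hirota Dx Dy Dt (expComb w p q r) = 0 := by
  refine Subtype.ext (funext fun x => funext fun y => funext fun t => ?_)
  suffices h : evalAt x y t (hirota Dx Dy Dt (expComb w p q r)) = 0 from h
  let EP : ι → ℝ := fun i => Real.exp (P i * x + yExponent (P i) * y + tExponent (P i) * t)
  let EQ : κ → ℝ := fun j => Real.exp (Q j * x + yExponent (Q j) * y + tExponent (Q j) * t)
  have hE : ∀ m, Real.exp (p m * x + q m * y + r m * t) = EP m.1 * EQ m.2 := fun m => by
    rw [← Real.exp_add, hp, hq, hr]
    ring_nf
  -- At a fixed point the exponentials are absorbed into the weights K and M, which leaves a purely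
  -- algebraic identity. The order r, q, p of the powers matches iterated derivatives, where `Dx`
  -- acts last.
  have key := hirota_exponential (fun i => K i * EP i) P (fun j => M j * EQ j) Q hPQ
    (fun m => w m * (EP m.1 * EQ m.2)) p q r (fun m => by rw [hw]; ring) hp hq hr
    (fun a b c => ∑ m, w m * (r m ^ c * (q m ^ b * p m ^ a)) * (EP m.1 * EQ m.2))
    (fun a b c => Finset.sum_congr rfl fun m _ => by ring)
  simp only [pow_zero, pow_succ, one_mul, mul_one] at key
  simp only [hirota, Dx_expComb, Dy_expComb, Dt_expComb, map_add, map_sub, map_mul, map_ofNat,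
    evalAt_expComb, hE]
  simp only [mul_assoc] at key ⊢
  exact key

end

end BKP

namespace BKP

open Filter Topology MeasureTheory

/-! ### The dispersion relation -/

/-- Division by zero gives zero, so a nonzero wave number certifies its own denominator. -/
theorem denominator_ne_zero {α β : ℝ} (h : waveNumber α β ≠ 0) : α ^ 2 + α * β + 81 ≠ 0 :=
  fun h0 => h (by rw [waveNumber, h0, div_zero])

/-- On the dispersion curve `waveNumber` recovers the parameter a of α = a³ + 3a, β = a⁵ + 5a³ +
15a. Once denominators are cleared, the claim is a polynomial multiple of the dispersion relation;
the cofactor is the quotient. -/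
theorem yExponent_waveNumber {α β : ℝ} (hd : IsDispersion α β) (h : waveNumber α β ≠ 0) :
    yExponent (waveNumber α β) = α := by
  have hne := denominator_ne_zero h
  rw [IsDispersion] at hd
  rw [yExponent, waveNumber]
  generalize hden : α ^ 2 + α * β + 81 = d at hne ⊢
  field_simp
  subst hden
  linear_combination (α ^ 4 - 27 * α ^ 2 - 729) * hd

theorem tExponent_waveNumber {α β : ℝ} (hd : IsDispersion α β) (h : waveNumber α β ≠ 0) :
    tExponent (waveNumber α β) = β := by
  have hne := denominator_ne_zero h
  rw [IsDispersion] at hd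
  rw [tExponent, waveNumber]
  generalize hden : α ^ 2 + α * β + 81 = d at hne ⊢
  field_simp
  subst hden
  linear_combination (-9565938 - 59049 * β ^ 2 - 295245 * α ^ 2 - 3645 * α ^ 2 * β ^ 2
    + 3645 * α ^ 3 * β + 40095 * α ^ 4 + 270 * α ^ 4 * β ^ 2 - 108 * α ^ 5 * β + α ^ 5 * β ^ 3
    + 1080 * α ^ 6 + 5 * α ^ 6 * β ^ 2 + 25 * α ^ 7 * β - 60 * α ^ 8 + α ^ 10) * hd

/-! ### Gauge data from exponential sums -/

section ExpSum

variable {ι : Type*} [Fintype ι]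

theorem hasDerivAt_exp_sum (F a : ι → ℝ) (x : ℝ) :
    HasDerivAt (fun s => ∑ i, F i * Real.exp (a i * s))
      (∑ i, F i * a i * Real.exp (a i * x)) x := by
  refine HasDerivAt.fun_sum fun i _ => ?_
  have h : HasDerivAt (fun s => a i * s) (a i) x := by
    simpa using (hasDerivAt_id x).const_mul (a i)
  exact (h.exp.const_mul (F i)).congr_deriv (by ring)

theorem deriv_exp_sum (F a : ι → ℝ) :
    (deriv fun s => ∑ i, F i * Real.exp (a i * s)) =
      fun x => ∑ i, F i * a i * Real.exp (a i * x) :=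
  funext fun x => (hasDerivAt_exp_sum F a x).deriv

theorem contDiff_exp_sum (F a : ι → ℝ) :
    ContDiff ℝ (⊤ : ℕ∞) fun s => ∑ i, F i * Real.exp (a i * s) := by
  fun_prop

theorem exp_sum_tendsto (F a : ι → ℝ) (ha : ∀ i, 0 < a i) :
    Tendsto (fun s => ∑ i, F i * Real.exp (a i * s)) atBot (𝓝 0) := by
  have h : ∀ i, Tendsto (fun s => F i * Real.exp (a i * s)) atBot (𝓝 0) := fun i => by
    simpa using (Real.tendsto_exp_atBot.comp
      (tendsto_id.const_mul_atBot (ha i))).const_mul (F i)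
  simpa using tendsto_finsetSum Finset.univ fun i _ => h i

theorem exp_sum_pos [Nonempty ι] {F : ι → ℝ} (a : ι → ℝ) (hF : ∀ i, 0 < F i) (x : ℝ) :
    0 < ∑ i, F i * Real.exp (a i * x) :=
  Finset.sum_pos (fun i _ => mul_pos (hF i) (Real.exp_pos _)) Finset.univ_nonempty

variable {κ : Type*} [Fintype κ] [Nonempty ι] [Nonempty κ]

/-- Integrating e^{as} · b e^{bs} termwise produces b/(a + b) in A, and likewise a/(a + b) in B. All
inequalities then hold term by term from 0 < a < b; the Wronskian has the factors b - a. -/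
theorem gaugeData_exp_sum {F a : ι → ℝ} {G b : κ → ℝ} (hF : ∀ i, 0 < F i) (hG : ∀ j, 0 < G j)
    (ha : ∀ i, 0 < a i) (hab : ∀ i j, a i < b j) :
    GaugeData (fun s => ∑ i, F i * Real.exp (a i * s)) (fun s => ∑ j, G j * Real.exp (b j * s))
      (fun s => ∑ m : ι × κ, F m.1 * G m.2 * (b m.2 / (b m.2 + a m.1)) *
        Real.exp ((a m.1 + b m.2) * s))
      (fun s => ∑ m : ι × κ, F m.1 * G m.2 * (a m.1 / (b m.2 + a m.1)) *
        Real.exp ((a m.1 + b m.2) * s)) := by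
  have hb : ∀ j, 0 < b j := fun j => (ha (Classical.arbitrary ι)).trans (hab _ j)
  have hs : ∀ i j, 0 < b j + a i := fun i j => add_pos (hb j) (ha i)
  have hexp : ∀ (m : ι × κ) (s : ℝ), Real.exp ((a m.1 + b m.2) * s) =
      Real.exp (a m.1 * s) * Real.exp (b m.2 * s) := fun m s => by
    rw [← Real.exp_add]
    ring_nf
  have hmul : ∀ (c : ι → ℝ) (d : κ → ℝ), (∑ i, c i) * ∑ j, d j = ∑ m : ι × κ, c m.1 * d m.2 :=
    fun c d => by rw [Finset.sum_mul_sum, ← Fintype.sum_prod_type']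
  exact
  { smooth_f := contDiff_exp_sum F a
    smooth_g := contDiff_exp_sum G b
    f_pos := exp_sum_pos a hF
    g_pos := exp_sum_pos b hG
    deriv_f_pos := fun x => by
      rw [deriv_exp_sum]
      exact exp_sum_pos a (fun i => mul_pos (hF i) (ha i)) x
    deriv_g_pos := fun x => by
      rw [deriv_exp_sum]
      exact exp_sum_pos b (fun i => mul_pos (hG i) (hb i)) x
    f_tendsto := exp_sum_tendsto F a ha
    g_tendsto := exp_sum_tendsto G b hb
    hasDerivAt_A := fun x => by
      refine (hasDerivAt_exp_sum _ _ x).congr_deriv ?_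
      rw [deriv_exp_sum, hmul]
      refine Finset.sum_congr rfl fun m _ => ?_
      have := (hs m.1 m.2).ne'
      rw [hexp]
      field_simp
      ring
    hasDerivAt_B := fun x => by
      refine (hasDerivAt_exp_sum _ _ x).congr_deriv ?_
      rw [deriv_exp_sum, mul_comm, hmul]
      refine Finset.sum_congr rfl fun m _ => ?_
      have := (hs m.1 m.2).ne'
      rw [hexp]
      field_simp
      ring
    add_eq := fun x => by
      rw [hmul, ← Finset.sum_add_distrib]
      refine Finset.sum_congr rfl fun m _ => ?_
      have := (hs m.1 m.2).ne'
      rw [hexp]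
      field_simp
    A_nonneg := fun x => Finset.sum_nonneg fun m _ => by
      have := hF m.1
      have := hG m.2
      have := hb m.2
      have := ha m.1
      positivity
    B_nonneg := fun x => Finset.sum_nonneg fun m _ => by
      have := hF m.1
      have := hG m.2
      have := hb m.2
      have := ha m.1
      positivity
    lt := fun x => by
      refine Finset.sum_lt_sum_of_nonempty Finset.univ_nonempty fun m _ => ?_
      have := hF m.1
      have := hG m.2
      have := hs m.1 m.2
      have := hab m.1 m.2
      gcongr
    wronskian_pos := fun x => by
      rw [deriv_exp_sum, deriv_exp_sum, hmul, mul_comm (∑ j, _), hmul, ← Finset.sum_sub_distrib]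
      refine Finset.sum_pos (fun m _ => ?_) Finset.univ_nonempty
      have h : 0 < F m.1 * G m.2 * (b m.2 - a m.1) * Real.exp (a m.1 * x) *
          Real.exp (b m.2 * x) := by
        have := hF m.1
        have := hG m.2
        have := sub_pos.2 (hab m.1 m.2)
        positivity
      linarith }

end ExpSum

/-! ### Logarithms of positive smooth functions -/

theorem isUnit_of_pos {τ : smoothFun} (hτ : ∀ x y t, 0 < (τ : Fun3) x y t) : IsUnit τ := by
  have hi : IsSmooth fun x y t => ((τ : Fun3) x y t)⁻¹ :=
    ContDiff.inv τ.2 fun p => (hτ p.1 p.2.1 p.2.2).ne'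
  refine IsUnit.of_mul_eq_one
    (⟨fun x y t => ((τ : Fun3) x y t)⁻¹, hi⟩ : smoothFun) ?_
  exact Subtype.ext (funext fun x => funext fun y => funext fun t =>
    mul_inv_cancel₀ (hτ x y t).ne')

theorem dirDeriv_eq_log_mul {τ L : smoothFun} (hτ : ∀ x y t, 0 < (τ : Fun3) x y t)
    (hL : ∀ x y t, (L : Fun3) x y t = Real.log ((τ : Fun3) x y t)) (v : ℝ × ℝ × ℝ) :
    dirDeriv v τ = dirDeriv v L * τ := by
  refine Subtype.ext (funext fun x => funext fun y => funext fun t => ?_)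
  have hfun : uncurry3 L = fun p => Real.log (uncurry3 τ p) :=
    funext fun p => hL p.1 p.2.1 p.2.2
  have hpos : 0 < uncurry3 τ (x, y, t) := hτ x y t
  have h1 := ((differentiableAt_uncurry3 τ (x, y, t)).hasFDerivAt.log hpos.ne').fderiv
  change fderiv ℝ (uncurry3 τ) (x, y, t) v =
    fderiv ℝ (uncurry3 L) (x, y, t) v * uncurry3 τ (x, y, t)
  rw [hfun, h1, smul_apply, smul_eq_mul]
  field_simp

theorem isSKSolution_coe {ℓ u v : smoothFun} (hu : u = 1 + Dx (Dx ℓ)) (hv : v = 6 + Dx (Dy ℓ))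
    (h : 9 * Dt u = 5 * Dy v + 15 * Dx u * v - Dx (Dx (Dx (Dx (Dx u)))) - 15 * u * Dx (Dx (Dx u))
      - 15 * Dx u * Dx (Dx u) - 45 * u ^ 2 * Dx u + 5 * Dy (Dx (Dx u)) + 15 * u * Dy u) :
    IsSKSolution u v := by
  refine ⟨u.2, v.2, ?_, fun x y t => ?_⟩
  · rw [dx_coe, dy_coe, hu, hv]
    refine congrArg Subtype.val ?_
    simp only [map_add, derivation_ofNat, Derivation.map_one_eq_zero, zero_add]
    rw [dirDeriv_comm (0, 1, 0) (1, 0, 0) (Dx ℓ), dirDeriv_comm (0, 1, 0) (1, 0, 0) ℓ]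
  · have h' := congrArg (evalAt x y t) h
    simp only [map_add, map_sub, map_mul, map_pow, map_ofNat, evalAt_apply] at h'
    simp only [dx_coe, dy_coe, dt_coe]
    linarith

end BKP

namespace BKP

open MeasureTheory

/-! ### Assembly: the function τ, the determinant and the solution. -/

variable {n₁ n₂ : ℕ}

/-- The function `τ` with `IW = - τ² / 4`. -/
noncomputable def tauFun (k₁ α₁ β₁ : Fin n₁ → ℝ) (k₂ α₂ β₂ : Fin n₂ → ℝ) : smoothFun :=
  expComb (μ := Fin n₁ × Fin n₂)
    (fun m => k₁ m.1 * k₂ m.2 *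
      ((waveNumber (α₂ m.2) (β₂ m.2) - waveNumber (α₁ m.1) (β₁ m.1)) /
        (waveNumber (α₂ m.2) (β₂ m.2) + waveNumber (α₁ m.1) (β₁ m.1))))
    (fun m => waveNumber (α₁ m.1) (β₁ m.1) + waveNumber (α₂ m.2) (β₂ m.2))
    (fun m => α₁ m.1 + α₂ m.2) (fun m => β₁ m.1 + β₂ m.2)

theorem expSum_slice {n : ℕ} (k α β : Fin n → ℝ) (y t : ℝ) :
    (fun s => expSum k α β s y t) = fun s => ∑ i, k i * Real.exp (α i * y + β i * t) *
      Real.exp (waveNumber (α i) (β i) * s) := by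
  funext s
  refine Finset.sum_congr rfl fun i _ => ?_
  rw [mul_assoc, ← Real.exp_add]
  ring_nf

/-- At fixed `y`, `t` two exponential sums form gauge data with `A - B = τ`. -/
theorem exists_gaugeData_expSum (hn₁ : 0 < n₁) (hn₂ : 0 < n₂)
    (k₁ α₁ β₁ : Fin n₁ → ℝ) (k₂ α₂ β₂ : Fin n₂ → ℝ)
    (hk₁ : ∀ i, 0 < k₁ i) (hk₂ : ∀ j, 0 < k₂ j)
    (ha : ∀ i, 0 < waveNumber (α₁ i) (β₁ i))
    (hab : ∀ i j, waveNumber (α₁ i) (β₁ i) < waveNumber (α₂ j) (β₂ j)) (y t : ℝ) :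
    ∃ A B : ℝ → ℝ, GaugeData (fun s => expSum k₁ α₁ β₁ s y t) (fun s => expSum k₂ α₂ β₂ s y t)
      A B ∧ ∀ s, A s - B s = (tauFun k₁ α₁ β₁ k₂ α₂ β₂ : Fun3) s y t := by
  have : Nonempty (Fin n₁) := ⟨⟨0, hn₁⟩⟩
  have : Nonempty (Fin n₂) := ⟨⟨0, hn₂⟩⟩
  rw [expSum_slice, expSum_slice]
  refine ⟨_, _, gaugeData_exp_sum (fun i => mul_pos (hk₁ i) (Real.exp_pos _))
    (fun j => mul_pos (hk₂ j) (Real.exp_pos _)) ha hab, fun s => ?_⟩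
  rw [tauFun, expComb_apply, ← Finset.sum_sub_distrib]
  refine Finset.sum_congr rfl fun m _ => ?_
  have e : Real.exp ((waveNumber (α₁ m.1) (β₁ m.1) + waveNumber (α₂ m.2) (β₂ m.2)) * s +
      (α₁ m.1 + α₂ m.2) * y + (β₁ m.1 + β₂ m.2) * t) =
      Real.exp (α₁ m.1 * y + β₁ m.1 * t) * Real.exp (α₂ m.2 * y + β₂ m.2 * t) *
      Real.exp ((waveNumber (α₁ m.1) (β₁ m.1) + waveNumber (α₂ m.2) (β₂ m.2)) * s) := by
    rw [← Real.exp_add, ← Real.exp_add]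
    ring_nf
  rw [e]
  ring

/-- The determinant of gauge data. -/
theorem IW_eq {φ₁ φ₂ : Fun3} {A B : ℝ → ℝ} {y t : ℝ}
    (h : GaugeData (fun s => φ₁ s y t) (fun s => φ₂ s y t) A B) (x : ℝ) :
    IW ![dx φ₂, dx φ₁] ![φ₁, φ₂] x y t = -((A x - B x) ^ 2 / 4) := by
  have e : IW ![dx φ₂, dx φ₁] ![φ₁, φ₂] x y t = A x * B x - φ₂ x y t ^ 2 / 2 * (φ₁ x y t ^ 2 / 2) := by
    rw [IW, Matrix.det_fin_two]
    exact congrArg₂ (· - ·) (congrArg₂ (· * ·) (h.integral_A x) (h.integral_B x))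
      (congrArg₂ (· * ·) (h.integral_gg x) (h.integral_ff x))
  have hAB : A x + B x = φ₁ x y t * φ₂ x y t := h.add_eq x
  rw [e]
  -- AB - (φ₁φ₂)²/4 + (A - B)²/4 equals ((A + B)² - (φ₁φ₂)²)/4, which has the factor A + B - φ₁φ₂.
  linear_combination ((1 / 4) * (A x + B x + φ₁ x y t * φ₂ x y t)) * hAB

theorem hirota_tauFun {k₁ α₁ β₁ : Fin n₁ → ℝ} {k₂ α₂ β₂ : Fin n₂ → ℝ}
    (hd₁ : ∀ i, IsDispersion (α₁ i) (β₁ i)) (hd₂ : ∀ j, IsDispersion (α₂ j) (β₂ j))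
    (ha : ∀ i, 0 < waveNumber (α₁ i) (β₁ i)) (hb : ∀ j, 0 < waveNumber (α₂ j) (β₂ j)) :
    hirota Dx Dy Dt (tauFun k₁ α₁ β₁ k₂ α₂ β₂) = 0 :=
  hirota_expComb k₁ (fun i => waveNumber (α₁ i) (β₁ i)) k₂ (fun j => waveNumber (α₂ j) (β₂ j))
    (fun i j => (add_pos (hb j) (ha i)).ne') _ _ _ _ (fun _ => rfl) (fun _ => rfl)
    (fun m => by
      rw [yExponent_waveNumber (hd₁ m.1) (ha m.1).ne', yExponent_waveNumber (hd₂ m.2) (hb m.2).ne'])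
    (fun m => by
      rw [tExponent_waveNumber (hd₁ m.1) (ha m.1).ne', tExponent_waveNumber (hd₂ m.2) (hb m.2).ne'])

/-- A positive solution `τ` of the bilinear equation gives a solution of the Sawada–Kotera
equation. -/
theorem isSKSolution_of_hirota {τ : smoothFun} (hpos : ∀ x y t, 0 < (τ : Fun3) x y t)
    (hB : hirota Dx Dy Dt τ = 0) {logI : Fun3}
    (hlog : ∀ x y t, logI x y t = Real.log |-((τ : Fun3) x y t ^ 2 / 4)|) :
    IsSKSolution (fun x y t => 1 + dx (dx logI) x y t) (fun x y t => 6 + dx (dy logI) x y t) := by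
  have hLs : IsSmooth fun x y t => Real.log ((τ : Fun3) x y t) :=
    ContDiff.log τ.2 fun p => (hpos p.1 p.2.1 p.2.2).ne'
  let L : smoothFun := ⟨fun x y t => Real.log ((τ : Fun3) x y t), hLs⟩
  -- log(τ²/4) = 2 log τ - log 4, and derivations kill the constant.
  let ℓ : smoothFun := 2 * L - algebraMap ℝ smoothFun (Real.log 4)
  have hℓ : logI = ℓ := by
    funext x y t
    have hne := (hpos x y t).ne'
    rw [hlog, Real.log_abs, Real.log_neg_eq_log, Real.log_div (pow_ne_zero 2 hne) four_ne_zero,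
      Real.log_pow]
    rfl
  have hD : ∀ v, dirDeriv v ℓ = 2 * dirDeriv v L := fun v => by
    simp [ℓ, Derivation.leibniz, derivation_ofNat]
  have hX := dirDeriv_eq_log_mul (L := L) hpos fun _ _ _ => rfl
  have h2 : ∀ v (f : smoothFun), dirDeriv v (2 * f) = 2 * dirDeriv v f := fun v f => by
    simp [Derivation.leibniz, derivation_ofNat]
  have h := isSKSolution_coe (ℓ := ℓ) rfl rfl
    (sawadaKotera_of_hirota Dx Dy Dt (fun f => dirDeriv_comm _ _ f) (fun f => dirDeriv_comm _ _ f)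
      (isUnit_of_pos hpos) (hX _) (hX _) (hX _) hB (by rw [hD, h2]) (by rw [hD, h2]))
  simp only [hℓ, dx_coe, dy_coe]
  exact h

end BKP

theorem theorem3 {n₁ n₂ : ℕ} (hn₁ : 0 < n₁) (hn₂ : 0 < n₂)
    (k₁ α₁ β₁ : Fin n₁ → ℝ) (k₂ α₂ β₂ : Fin n₂ → ℝ)
    (hk₁ : ∀ i, 0 < k₁ i) (hk₂ : ∀ j, 0 < k₂ j)
    (hd₁ : ∀ i, BKP.IsDispersion (α₁ i) (β₁ i)) (hd₂ : ∀ j, BKP.IsDispersion (α₂ j) (β₂ j))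
    (ha : ∀ i j, 0 < 3 * BKP.waveNumber (α₁ i) (β₁ i) ∧
      3 * BKP.waveNumber (α₁ i) (β₁ i) < BKP.waveNumber (α₂ j) (β₂ j)) :
    let φ₁ : BKP.Fun3 := BKP.expSum k₁ α₁ β₁
    let φ₂ : BKP.Fun3 := BKP.expSum k₂ α₂ β₂
    let I : BKP.Fun3 := BKP.IW ![BKP.dx φ₂, BKP.dx φ₁] ![φ₁, φ₂]
    let logI : BKP.Fun3 := fun x y t => Real.log |I x y t|
    let u : BKP.Fun3 := fun x y t => 1 + BKP.dx (BKP.dx logI) x y t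
    let v : BKP.Fun3 := fun x y t => 6 + BKP.dx (BKP.dy logI) x y t
    -- the integrals in the determinant converge
    (∀ i j : Fin 2, ∀ x y t : ℝ, MeasureTheory.IntegrableOn
      (fun s => ![φ₁, φ₂] j s y t * ![BKP.dx φ₂, BKP.dx φ₁] i s y t) (Set.Iic x)) ∧
    -- the determinant is negative
    (∀ x y t, I x y t < 0) ∧
    -- the gauge-transformed function is `1 + (log IW)_xx`
    BKP.gaugedU2 φ₁ φ₂ = u ∧
    -- it is a nonsingular solution, with `∂ₓ⁻¹u_y = 6 + (log IW)_xy`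
    BKP.IsSKSolution u v := by

  intro φ₁ φ₂ I logI u v
  have ha₁ : ∀ i, 0 < BKP.waveNumber (α₁ i) (β₁ i) := fun i => by
    have := (ha i ⟨0, hn₂⟩).1
    linarith
  have hab : ∀ i j, BKP.waveNumber (α₁ i) (β₁ i) < BKP.waveNumber (α₂ j) (β₂ j) := fun i j => by
    have := ha i j
    linarith
  have ha₂ : ∀ j, 0 < BKP.waveNumber (α₂ j) (β₂ j) := fun j =>
    (ha₁ ⟨0, hn₁⟩).trans (hab _ j)
  have hG := BKP.exists_gaugeData_expSum hn₁ hn₂ k₁ α₁ β₁ k₂ α₂ β₂ hk₁ hk₂ ha₁ hab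
  let τ := BKP.tauFun k₁ α₁ β₁ k₂ α₂ β₂
  have hτ : ∀ x y t, 0 < (τ : BKP.Fun3) x y t := fun x y t => by
    obtain ⟨A, B, h, hAB⟩ := hG y t
    exact (h.tau_pos x).trans_eq (hAB x)
  have hI : ∀ x y t, I x y t = -((τ : BKP.Fun3) x y t ^ 2 / 4) := fun x y t => by
    obtain ⟨A, B, h, hAB⟩ := hG y t
    rw [← hAB x]
    exact BKP.IW_eq h x
  refine ⟨fun i j x y t => ?_, fun x y t => ?_, ?_, ?_⟩
  · obtain ⟨A, B, h, -⟩ := hG y t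
    fin_cases i <;> fin_cases j
    · exact h.integrableOn_A x
    · exact h.integrableOn_gg x
    · exact h.integrableOn_ff x
    · exact h.integrableOn_B x
  · rw [hI]
    have := hτ x y t
    exact neg_neg_of_pos (by positivity)
  · funext x y t
    obtain ⟨A, B, h, hAB⟩ := hG y t
    refine (h.gauge22_seedLax x).trans ?_
    have e : (fun s => Real.log |-((A s - B s) ^ 2 / 4)|) = fun s => logI s y t := by
      funext s
      rw [hAB s]
      exact (congrArg (fun z => Real.log |z|) (hI s y t)).symm
    rw [e]
    rfl
  · exact BKP.isSKSolution_of_hirota hτ (BKP.hirota_tauFun hd₁ hd₂ ha₁ ha₂)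
      fun x y t => congrArg (fun z => Real.log |z|) (hI x y t)
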